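/- Write $s=\sigma+i\tau$ with $\sigma,\tau\in\mathbb R$. Let $a\in\mathbb{R}$ and let $h$ be a meromorphic function on $\mathbb{C}$, real on the real axis (away from its poles), with finitely many poles in $\mathbb{C}$, finitely many zeros in the half-plane $\sigma>a$, and holomorphic and nonvanishing on the line $\sigma=a$. For a choice of sign $\pm$, put $$f(s)=f^{\pm}(s)=h(s)\pm h(2a-s),\qquad F(s)=\frac{h(2a-s)}{h(s)},$$ so that $f(2a-s)=\pm f(s)$. Assume that (i) for every $\eta>0$ there is $\sigma_0=\sigma_0(\eta)>a$ such that $|F(s)|<\eta$ whenever $\sigma\ge\sigma_0$, $\tau\in\mathbb{R}$; (ii) for all $\varepsilon>0$ and $\sigma_0>a$ there is a real sequence $(T_n)_n$ with $\lim_{n\to\infty}T_n=+\infty$ such that $|F(s)|<e^{\varepsilon|s|}$ whenever $a\le\sigma\le\sigma_0$ and $|\tau|=T_n$ for some $n$. (The bounds in (i) and (ii) include that the meromorphic function $F$ has no pole at the points concerned.) For $T>0$ let $N(T)$ be the number of zeros of $f$ with $0<\tau<T$ and $N_0(T)$ the number of those with moreover $\sigma=a$, both counted with multiplicity, and let $N_0'(T)$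 be the number of distinct zeros of $f$ with $\sigma=a$, $0<\tau<T$. Counting with multiplicity, let $n_{f,\sigma>a}$ be the number of real zeros $\sigma$ of $f$ with $\sigma>a$; $n_{f,a}$ the multiplicity of $a$ as a zero of $f$ (with $n_{f,a}=0$ if $f(a)\neq0$); $P_{f,\sigma>a}$ and $P_{h,\sigma>a}$ the numbers of poles of $f$ and of $h$ in the half-plane $\sigma>a$; and $N_{h,\sigma>a}$ the number of zeros of $h$ in the half-plane $\sigma>a$. Let $u_+=\tfrac12$ and $u_-=1$. Then all these quantities are finite, and for every $T>0$ $$N(T)-N_0(T)\;\le\; N(T)-N_0'(T)\;\le\; u_{\pm}-n_{f,\sigma>a}-\frac{n_{f,a}}{2}+P_{f,\sigma>a}+N_{h,\sigma>a}-P_{h,\sigma>a}.$$ Moreover $n_{f,a}=0$ in the case $+$, while $n_{f,a}\ge1$ is odd in the case $-$. All but finitely many zeros of $f$ lie on the line $\sigma=a$ and are simple. Finally, $N(T)-N_0(T)$ is a nonnegative even integer for every $T>0$. -/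

import Mathlib

open Filter Topology

/-! Meromorphic functions on `ℂ` are represented by functions `ℂ → ℂ` satisfying Mathlib's
`Meromorphic`.  The raw values at isolated points carry no information, so zeros, poles and values
are read off from the order and from the normal form. -/

/-- `s` is a zero of the meromorphic function `m`. -/
def IsZeroAt (m : ℂ → ℂ) (s : ℂ) : Prop := 0 < meromorphicOrderAt m s

/-- `s` is a pole of the meromorphic function `m`. -/
def IsPoleAt (m : ℂ → ℂ) (s : ℂ) : Prop := meromorphicOrderAt m s < 0

/-- The multiplicity of `s` as a zero of `m` (`0` if `s` is not a zero). -/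
noncomputable def zeroMult (m : ℂ → ℂ) (s : ℂ) : ℕ := (meromorphicOrderAt m s).untop₀.toNat

/-- The multiplicity of `s` as a pole of `m` (`0` if `s` is not a pole). -/
noncomputable def poleMult (m : ℂ → ℂ) (s : ℂ) : ℕ := (-(meromorphicOrderAt m s).untop₀).toNat

/-- The value of the meromorphic function `m` at a point `s` that is not a pole, removable
singularities being filled in. -/
noncomputable def meroValue (m : ℂ → ℂ) (s : ℂ) : ℂ := toMeromorphicNFAt m s s

/-- The meromorphic function `m` is holomorphic at `s` and its value there has modulus `< r`. -/
def NormLtAt (m : ℂ → ℂ) (s : ℂ) (r : ℝ) : Prop := ¬ IsPoleAt m s ∧ ‖meroValue m s‖ < r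

/-- `m` is real on the real axis (away from its poles). -/
def RealOnRealAxis (m : ℂ → ℂ) : Prop := ∀ x : ℝ, ¬ IsPoleAt m x → (meroValue m x).im = 0

/-- Number of zeros of `m` in `S`, counted with multiplicity. -/
noncomputable def zeroCount (m : ℂ → ℂ) (S : Set ℂ) : ℕ := ∑ᶠ s ∈ S, zeroMult m s

/-- Number of poles of `m` in `S`, counted with multiplicity. -/
noncomputable def poleCount (m : ℂ → ℂ) (S : Set ℂ) : ℕ := ∑ᶠ s ∈ S, poleMult m s

/-- The open half-plane `σ > a`. -/
def rightHalfPlane (a : ℝ) : Set ℂ := {s | a < s.re}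

/-- The real half-line `σ > a`, as a subset of `ℂ`. -/
def rightHalfLine (a : ℝ) : Set ℂ := {s | a < s.re ∧ s.im = 0}

/-- The open horizontal strip `0 < τ < T`. -/
def strip (T : ℝ) : Set ℂ := {s | 0 < s.im ∧ s.im < T}

/-- The part of the line `σ = a` with `0 < τ < T`. -/
def criticalSegment (a T : ℝ) : Set ℂ := {s | s.re = a ∧ 0 < s.im ∧ s.im < T}

/-- `f(s) = h(s) ± h(2a - s)`, the sign being `ε = 1` or `ε = -1`. -/
def symComb (h : ℂ → ℂ) (a : ℝ) (ε : ℤˣ) : ℂ → ℂ :=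
  fun s => h s + ((ε : ℤ) : ℂ) * h (2 * (a : ℂ) - s)

/-- `F(s) = h(2a - s) / h(s)`. -/
noncomputable def reflQuot (h : ℂ → ℂ) (a : ℝ) : ℂ → ℂ :=
  fun s => h (2 * (a : ℂ) - s) / h s

/-- `u₊ = 1/2` and `u₋ = 1`. -/
noncomputable def uConst (ε : ℤˣ) : ℝ := if ε = 1 then 1 / 2 else 1

/-- `N(T)`: number of zeros of `f` with `0 < τ < T`, with multiplicity. -/
noncomputable def zerosN (f : ℂ → ℂ) (T : ℝ) : ℕ := zeroCount f (strip T)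

/-- `N₀(T)`: number of zeros of `f` with `σ = a`, `0 < τ < T`, with multiplicity. -/
noncomputable def zerosN₀ (f : ℂ → ℂ) (a T : ℝ) : ℕ := zeroCount f (criticalSegment a T)

/-- `N₀'(T)`: number of distinct zeros of `f` with `σ = a`, `0 < τ < T`. -/
noncomputable def zerosN₀' (f : ℂ → ℂ) (a T : ℝ) : ℕ :=
  {s | s ∈ criticalSegment a T ∧ IsZeroAt f s}.ncard

/-! Write `f = h·g` with `g = 1 ± F`. Since `h` commutes with conjugation, `|F| = 1` on `σ = a`, so
`Re g ≥ 0` there. Hypotheses (i) and (ii) with Phragmén–Lindelöf make `g` bounded near infinity in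
`σ ≥ a` (`exists_norm_reflQuotNF_le`).

Zeros are counted without the argument principle. Multiply `g` by powers of `-(s - p)(s - p*)`,
where `p*` is the mirror image of `p` in the line. On the line this factor is `|s - p|²`, so signs
are preserved. One factor removes one zero or pole with `σ > a`, or two zeros on the line. If more
factors could be divided out than multiplied in, the product would be holomorphic and `O(|s|⁻²)`
with nonnegative real part on the line. By Cauchy its integral there tends to zero, so `g` would
vanish on the line: a contradiction (`sum_compensating_weights_nonneg`).

Hence the zeros of `f` with `σ > a`, plus `⌊m/2⌋` for each zero of multiplicity `m` on the line,
number at most `P_f + N_h - P_h` (`sum_zeroWeight_le`). So almost all zeros are simple and on the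
line. Reflection in the line and `m - 1 ≤ 2⌊m/2⌋` bound `N - N₀'` by twice the weight above the real
axis (`zerosN₀'_le`). Conjugation turns this into the weight off the real axis, leaving room for the
real zeros (`two_mul_finsum_zeroWeight_le`). Rounding at `s = a` costs at most `1/2`. -/

/-! ### Cauchy's theorem in a half-plane. -/

/-- A holomorphic function that is `O(|s|⁻²)` on a closed half-plane has integral `O(1/T)` over the
boundary segment `|τ| ≤ T`. -/
lemma norm_integral_vertical_line_le {a C R T : ℝ} {Φ : ℂ → ℂ}
    (hd : ∀ z : ℂ, a ≤ z.re → DifferentiableAt ℂ Φ z)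
    (hb : ∀ z : ℂ, a ≤ z.re → R ≤ ‖z‖ → ‖Φ z‖ ≤ C / ‖z‖ ^ 2)
    (hC : 0 ≤ C) (hR : R ≤ T) (hT : 0 < T) (haT : |a| ≤ T) :
    ‖∫ y : ℝ in (-T)..T, Φ (a + y * Complex.I)‖ ≤ 8 * C / T := by
  have hb' : ∀ z : ℂ, a ≤ z.re → T ≤ ‖z‖ → ‖Φ z‖ ≤ C / T ^ 2 := fun z h1 h2 =>
    (hb z h1 (hR.trans h2)).trans (by gcongr)
  have haa := neg_abs_le a
  have haa' := le_abs_self a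
  -- With right edge at `|a| + T`, the other three sides stay at distance at least `T` from the
  -- origin. Their lengths are at most `3T`, `3T` and `2T`, whence the constant 8.
  have key := Complex.integral_boundary_rect_eq_zero_of_differentiableOn Φ
    (⟨a, -T⟩ : ℂ) (⟨|a| + T, T⟩ : ℂ) (by
      intro z hz
      rw [Complex.mem_reProdIm] at hz
      refine (hd z ?_).differentiableWithinAt
      have := hz.1
      simp only [Set.uIcc_of_le (show a ≤ |a| + T by linarith)] at this
      exact this.1)
  simp only at key
  have e1 : ‖∫ x : ℝ in a..(|a| + T), Φ (x + ((-T : ℝ) : ℂ) * Complex.I)‖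
      ≤ C / T ^ 2 * |(|a| + T) - a| := by
    refine intervalIntegral.norm_integral_le_of_norm_le_const fun x hx => hb' _ ?_ ?_
    · rw [Set.uIoc_of_le (by linarith)] at hx
      simpa using hx.1.le
    · refine le_trans ?_ (Complex.abs_im_le_norm _)
      simp [abs_of_pos hT]
  have e2 : ‖∫ x : ℝ in a..(|a| + T), Φ (x + ((T : ℝ) : ℂ) * Complex.I)‖
      ≤ C / T ^ 2 * |(|a| + T) - a| := by
    refine intervalIntegral.norm_integral_le_of_norm_le_const fun x hx => hb' _ ?_ ?_
    · rw [Set.uIoc_of_le (by linarith)] at hx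
      simpa using hx.1.le
    · refine le_trans ?_ (Complex.abs_im_le_norm _)
      simp [abs_of_pos hT]
  have e3 : ‖∫ y : ℝ in (-T)..T, Φ (((|a| + T : ℝ) : ℂ) + y * Complex.I)‖
      ≤ C / T ^ 2 * |T - (-T)| := by
    refine intervalIntegral.norm_integral_le_of_norm_le_const fun x hx => hb' _ ?_ ?_
    · simp; linarith
    · refine le_trans ?_ (Complex.abs_re_le_norm _)
      simp only [Complex.add_re, Complex.ofReal_re, Complex.mul_re, Complex.I_re, mul_zero,
        Complex.ofReal_im, Complex.I_im, mul_one, sub_self, add_zero]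
      rw [abs_of_nonneg (by positivity)]
      linarith [abs_nonneg a]
  have e4 : |(|a| + T) - a| ≤ 3 * T := by
    rw [abs_of_nonneg (by linarith)]; linarith
  have e5 : |T - (-T)| = 2 * T := by
    rw [abs_of_nonneg (by linarith)]; ring
  rw [e5] at e3
  have e6 : C / T ^ 2 * |(|a| + T) - a| ≤ C / T ^ 2 * (3 * T) := by gcongr
  set A := ∫ x : ℝ in a..(|a| + T), Φ (x + ((-T : ℝ) : ℂ) * Complex.I)
  set B := ∫ x : ℝ in a..(|a| + T), Φ (x + ((T : ℝ) : ℂ) * Complex.I)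
  set D := ∫ y : ℝ in (-T)..T, Φ (((|a| + T : ℝ) : ℂ) + y * Complex.I)
  set E := ∫ y : ℝ in (-T)..T, Φ (a + y * Complex.I)
  have hE : ‖E‖ = ‖A - B + Complex.I • D‖ := by
    rw [sub_eq_zero.1 key, norm_smul, Complex.norm_I, one_mul]
  have h8 : C / T ^ 2 * (3 * T) + C / T ^ 2 * (3 * T) + C / T ^ 2 * (2 * T) = 8 * C / T := by
    field_simp; ring
  rw [hE, ← h8]
  calc ‖A - B + Complex.I • D‖ ≤ ‖A‖ + ‖B‖ + ‖Complex.I • D‖ :=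
        (norm_add_le _ _).trans (by gcongr; exact norm_sub_le _ _)
    _ ≤ _ := by
        rw [norm_smul, Complex.norm_I, one_mul]
        linarith

/-- A holomorphic function on a closed half-plane which is `O(|s|⁻²)` and has nonnegative real part
on the boundary line has vanishing real part there. -/
lemma re_eq_zero_on_line_of_isBigO {a C R : ℝ} {Φ : ℂ → ℂ}
    (hd : ∀ z : ℂ, a ≤ z.re → DifferentiableAt ℂ Φ z)
    (hb : ∀ z : ℂ, a ≤ z.re → R ≤ ‖z‖ → ‖Φ z‖ ≤ C / ‖z‖ ^ 2) (hC : 0 ≤ C)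
    (hnn : ∀ y : ℝ, 0 ≤ (Φ (a + y * Complex.I)).re) (y₀ : ℝ) :
    (Φ (a + y₀ * Complex.I)).re = 0 := by
  have hcont : Continuous fun y : ℝ => Φ (a + y * Complex.I) := by
    rw [continuous_iff_continuousAt]
    intro y
    refine ContinuousAt.comp (f := fun y : ℝ => (a : ℂ) + y * Complex.I) (g := Φ)
      (hd _ (by simp)).continuousAt ?_
    fun_prop
  have hcre : Continuous fun y : ℝ => (Φ (a + y * Complex.I)).re :=
    Complex.continuous_re.comp hcont
  by_contra hne
  have hpos : 0 < (Φ (a + y₀ * Complex.I)).re := lt_of_le_of_ne (hnn _) (Ne.symm hne)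
  -- The integrand is nonnegative, so this mass persists in every larger interval, while the whole
  -- integral is `O(1/T)`.
  set δ := ∫ y : ℝ in (y₀ - 1)..(y₀ + 1), (Φ (a + y * Complex.I)).re with hδ
  have hδpos : 0 < δ :=
    intervalIntegral.integral_pos (by linarith) hcre.continuousOn (fun y _ => hnn y)
      ⟨y₀, ⟨by linarith, by linarith⟩, hpos⟩
  have hlim : Tendsto (fun T : ℝ => 8 * C / T) atTop (𝓝 0) := tendsto_const_nhds.div_atTop tendsto_id
  obtain ⟨T, hT1, hT2⟩ := ((hlim.eventually (gt_mem_nhds hδpos)).and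
    (eventually_ge_atTop (max R 1 + |a| + |y₀| + 1))).exists
  have hR1 : R ≤ max R 1 := le_max_left _ _
  have hR2 : 1 ≤ max R 1 := le_max_right _ _
  have := abs_nonneg a
  have := abs_nonneg y₀
  have hy1 := neg_abs_le y₀
  have hy2 := le_abs_self y₀
  have h1 := norm_integral_vertical_line_le hd hb hC (T := T) (by linarith)
    (by linarith) (by linarith)
  have h2 : (∫ y : ℝ in (-T)..T, Φ (a + y * Complex.I)).re
      = ∫ y : ℝ in (-T)..T, (Φ (a + y * Complex.I)).re := by
    have := Complex.reCLM.intervalIntegral_comp_comm (hcont.intervalIntegrable (-T) T)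
      (μ := MeasureTheory.volume)
    simpa using this.symm
  have h3 : δ ≤ ∫ y : ℝ in (-T)..T, (Φ (a + y * Complex.I)).re :=
    intervalIntegral.integral_mono_interval (by linarith) (by linarith) (by linarith)
      (Eventually.of_forall fun y => hnn y) (hcre.intervalIntegrable _ _)
  have h4 := (Complex.re_le_norm (∫ y : ℝ in (-T)..T, Φ (a + y * Complex.I)))
  linarith

/-! ### Phragmén–Lindelöf in a half-strip. -/

/-- A Phragmén–Lindelöf principle for a half-strip, with growth control only on a sequence of
horizontal segments. -/
lemma norm_le_on_half_strip {a σ₀ R₀ M : ℝ} {G : ℂ → ℂ} (hM : 1 ≤ M) (hσ : a < σ₀) (hR : 0 ≤ R₀)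
    (hd : ∀ z : ℂ, a ≤ z.re → z.re ≤ σ₀ → R₀ ≤ z.im → DifferentiableAt ℂ G z)
    (hbot : ∀ z : ℂ, a ≤ z.re → z.re ≤ σ₀ → z.im = R₀ → ‖G z‖ ≤ M)
    (hleft : ∀ z : ℂ, z.re = a → R₀ ≤ z.im → ‖G z‖ ≤ M)
    (hright : ∀ z : ℂ, z.re = σ₀ → R₀ ≤ z.im → ‖G z‖ ≤ M)
    (hgrow : ∀ δ > 0, ∃ t : ℕ → ℝ, Tendsto t atTop atTop ∧ ∀ (n : ℕ) (z : ℂ),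
      a ≤ z.re → z.re ≤ σ₀ → z.im = t n → ‖G z‖ ≤ Real.exp (δ * ‖z‖))
    {s : ℂ} (hs1 : a ≤ s.re) (hs2 : s.re ≤ σ₀) (hs3 : R₀ ≤ s.im) : ‖G s‖ ≤ M := by
  set c := |a| + |σ₀| with hc
  have hnormle : ∀ z : ℂ, a ≤ z.re → z.re ≤ σ₀ → 0 ≤ z.im → ‖z‖ ≤ c + z.im := by
    intro z h1 h2 h3
    refine (Complex.norm_le_abs_re_add_abs_im z).trans ?_
    rw [abs_of_nonneg h3]
    gcongr
    exact (abs_le_max_abs_abs h1 h2).trans (max_le_add_of_nonneg (abs_nonneg _) (abs_nonneg _))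
  have hdn : ∀ (δ : ℝ) (z : ℂ), ‖Complex.exp (δ * Complex.I * z)‖ = Real.exp (-(δ * z.im)) := by
    intro δ z
    rw [Complex.norm_exp]
    simp
  -- The damping factor `exp(iδz)` has modulus `exp(-δ Im z)`. As `|z| ≤ c + Im z`, it reduces the
  -- growth `exp(δ|z|)` on the top edge to `exp(δc)`; afterwards `δ → 0`.
  have step : ∀ δ > 0, ‖G s‖ ≤ Real.exp (δ * s.im) * (M * Real.exp (δ * c)) := by
    intro δ hδ
    obtain ⟨t, ht, hgt⟩ := hgrow δ hδ
    obtain ⟨n, hn⟩ := (ht.eventually (eventually_gt_atTop (s.im + R₀))).exists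
    have hc0 : 0 ≤ c := by positivity
    have he1 : 1 ≤ Real.exp (δ * c) := Real.one_le_exp (by positivity)
    set U : Set ℂ := Set.Ioo a σ₀ ×ℂ Set.Ioo R₀ (t n)
    have htn : R₀ < t n := by linarith
    have hcl : closure U = Set.Icc a σ₀ ×ℂ Set.Icc R₀ (t n) := by
      rw [Complex.closure_reProdIm, closure_Ioo hσ.ne, closure_Ioo htn.ne]
    have hbdd : Bornology.IsBounded U :=
      (Bornology.IsBounded.reProdIm (Metric.isBounded_Ioo _ _) (Metric.isBounded_Ioo _ _))
    have hdiff : ∀ z ∈ closure U, DifferentiableAt ℂ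
        (fun z => Complex.exp (δ * Complex.I * z) * G z) z := by
      intro z hz
      rw [hcl, Complex.mem_reProdIm] at hz
      exact (by fun_prop : DifferentiableAt ℂ (fun z => Complex.exp (δ * Complex.I * z)) z).mul
        (hd z hz.1.1 hz.1.2 hz.2.1)
    have hDC : DiffContOnCl ℂ (fun z => Complex.exp (δ * Complex.I * z) * G z) U :=
      DifferentiableOn.diffContOnCl fun z hz => (hdiff z hz).differentiableWithinAt
    have hfr : ∀ z ∈ frontier U,
        ‖(fun z => Complex.exp (δ * Complex.I * z) * G z) z‖ ≤ M * Real.exp (δ * c) := by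
      intro z hz
      have hzc := frontier_subset_closure hz
      rw [hcl, Complex.mem_reProdIm] at hzc
      obtain ⟨⟨h1, h2⟩, h3, h4⟩ := hzc
      have him : 0 ≤ z.im := by linarith
      simp only [norm_mul, hdn]
      have hsmall : ‖G z‖ ≤ M → Real.exp (-(δ * z.im)) * ‖G z‖ ≤ M * Real.exp (δ * c) := by
        intro hG
        have hE : Real.exp (-(δ * z.im)) ≤ 1 := Real.exp_le_one_iff.2 (by
          have : 0 ≤ δ * z.im := by positivity
          linarith)
        calc Real.exp (-(δ * z.im)) * ‖G z‖ ≤ 1 * M := by gcongr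
          _ = M * 1 := by ring
          _ ≤ _ := by gcongr
      rcases eq_or_lt_of_le h1 with h1' | h1'
      · exact hsmall (hleft z h1'.symm h3)
      rcases eq_or_lt_of_le h2 with h2' | h2'
      · exact hsmall (hright z h2' h3)
      rcases eq_or_lt_of_le h3 with h3' | h3'
      · exact hsmall (hbot z h1 h2 h3'.symm)
      rcases eq_or_lt_of_le h4 with h4' | h4'
      · have hG := hgt n z h1 h2 h4'
        calc Real.exp (-(δ * z.im)) * ‖G z‖
            ≤ Real.exp (-(δ * z.im)) * Real.exp (δ * (c + z.im)) := by
              gcongr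
              refine hG.trans (Real.exp_le_exp.2 ?_)
              gcongr
              exact hnormle z h1 h2 him
          _ = 1 * Real.exp (δ * c) := by rw [← Real.exp_add, one_mul]; congr 1; ring
          _ ≤ _ := by gcongr
      · exfalso
        have hop : IsOpen U := isOpen_Ioo.reProdIm isOpen_Ioo
        rw [hop.frontier_eq] at hz
        exact hz.2 (by rw [Complex.mem_reProdIm]; exact ⟨⟨h1', h2'⟩, h3', h4'⟩)
    have hsU : s ∈ closure U := by
      rw [hcl, Complex.mem_reProdIm]
      exact ⟨⟨hs1, hs2⟩, hs3, by linarith⟩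
    have := Complex.norm_le_of_forall_mem_frontier_norm_le hbdd hDC hfr hsU
    simp only [norm_mul, hdn] at this
    calc ‖G s‖ = Real.exp (δ * s.im) * (Real.exp (-(δ * s.im)) * ‖G s‖) := by
          rw [← mul_assoc, ← Real.exp_add]; simp
      _ ≤ _ := by gcongr
  have hlim : Tendsto (fun δ : ℝ => Real.exp (δ * s.im) * (M * Real.exp (δ * c))) (𝓝[>] 0)
      (𝓝 M) := by
    have : ContinuousAt (fun δ : ℝ => Real.exp (δ * s.im) * (M * Real.exp (δ * c))) 0 := by
      fun_prop
    have h0 := this.tendsto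
    simp only [zero_mul, Real.exp_zero, one_mul, mul_one] at h0
    exact h0.mono_left nhdsWithin_le_nhds
  exact ge_of_tendsto hlim (eventually_nhdsWithin_of_forall fun δ hδ => step δ hδ)

lemma Set.Finite.eventually_nhdsNE_notMem {X : Type*} [TopologicalSpace X] [T1Space X] {S : Set X}
    (hS : S.Finite) (x : X) : ∀ᶠ z in 𝓝[≠] x, z ∉ S := by
  have h : (S \ {x})ᶜ ∈ 𝓝 x :=
    (hS.subset Set.sdiff_subset).isClosed.isOpen_compl.mem_nhds (by simp)
  filter_upwards [nhdsWithin_le_nhds h, self_mem_nhdsWithin] with z h1 h2 h3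
  exact h1 ⟨h3, h2⟩

/-! ### Rational weights that are nonnegative on the line. -/

/-- The polynomial `s ↦ -(s - p)(s - p*)`, where `p* = 2a - conj p`; it is `|s - p|²` on the line
`σ = a`. -/
noncomputable def lineWeight (a : ℝ) (p s : ℂ) : ℂ :=
  (s - p) * -(s - (2 * (a : ℂ) - starRingEnd ℂ p))

lemma lineWeight_of_re_eq {a : ℝ} (p : ℂ) {s : ℂ} (hs : s.re = a) :
    lineWeight a p s = (Complex.normSq (s - p) : ℂ) := by
  rw [← Complex.mul_conj, lineWeight]
  congr 1
  subst hs
  apply Complex.ext <;> simp <;> ring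

/-- The second root is the mirror image of `p`. It lies in `σ ≤ a`, hence meets the closed
half-plane only when it coincides with `p`. -/
lemma lineWeight_ne_zero {a : ℝ} {p s : ℂ} (hp : a ≤ p.re) (hs : a ≤ s.re) (hne : s ≠ p) :
    lineWeight a p s ≠ 0 := by
  refine mul_ne_zero (sub_ne_zero.2 hne) (neg_ne_zero.2 (sub_ne_zero.2 fun h => hne ?_))
  have h1 := congrArg Complex.re h
  have h2 := congrArg Complex.im h
  simp at h1 h2
  apply Complex.ext
  · linarith
  · exact h2

@[fun_prop]
lemma analyticAt_lineWeight (a : ℝ) (p s : ℂ) : AnalyticAt ℂ (lineWeight a p) s := by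
  unfold lineWeight
  fun_prop

/-- The two roots merge exactly when `p` is on the line; this doubling is why zeros there are
removed in pairs. -/
lemma meromorphicOrderAt_lineWeight_self {a : ℝ} {p : ℂ} :
    meromorphicOrderAt (lineWeight a p) p = if p.re = a then 2 else 1 := by
  have hfac : lineWeight a p = (· - p) * fun s => -(s - (2 * (a : ℂ) - starRingEnd ℂ p)) := rfl
  rw [hfac, meromorphicOrderAt_mul (by fun_prop) (by fun_prop), meromorphicOrderAt_id_sub_const]
  split_ifs with h
  · have : (2 * (a : ℂ) - starRingEnd ℂ p) = p := by
      apply Complex.ext <;> simp [h]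
      ring
    rw [this, ← meromorphicOrderAt_fun_neg, meromorphicOrderAt_id_sub_const]
    rfl
  · have han : AnalyticAt ℂ (fun s : ℂ => -(s - (2 * (a : ℂ) - starRingEnd ℂ p))) p := by fun_prop
    have h0 : meromorphicOrderAt (fun s : ℂ => -(s - (2 * (a : ℂ) - starRingEnd ℂ p))) p = 0 := by
      rw [← han.meromorphicNFAt.meromorphicOrderAt_eq_zero_iff.symm.eq]
      intro hz
      apply h
      have := congrArg Complex.re hz
      simp at this
      linarith
    rw [h0, add_zero]

lemma lineWeight_isTheta (a : ℝ) (p : ℂ) :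
    lineWeight a p =Θ[Bornology.cobounded ℂ] fun z => z ^ 2 := by
  have h : ∀ q : ℂ, (fun z : ℂ => z - q) =Θ[Bornology.cobounded ℂ] fun z => z := fun q => by
    refine Asymptotics.IsEquivalent.isTheta ?_
    refine Asymptotics.IsLittleO.congr_left (f₁ := fun _ => -q)
      (Asymptotics.isLittleO_const_id_cobounded _) fun z => ?_
    simp
  simp only [pow_two]
  exact (h p).mul ⟨(h _).1.neg_left, (h _).2.neg_right⟩

/-- `∏ lineWeight a p ^ e p`, a rational function which is nonnegative on the line `σ = a`. -/
noncomputable def lineWeightProd (a : ℝ) (S : Finset ℂ) (e : ℂ → ℤ) (s : ℂ) : ℂ :=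
  ∏ p ∈ S, lineWeight a p s ^ e p

lemma analyticAt_lineWeightProd {a : ℝ} {S : Finset ℂ} {e : ℂ → ℤ} (hS : ∀ p ∈ S, a ≤ p.re)
    {s : ℂ} (hs : a ≤ s.re) (hsS : s ∉ S) :
    AnalyticAt ℂ (lineWeightProd a S e) s ∧ lineWeightProd a S e s ≠ 0 := by
  have hne : ∀ p ∈ S, lineWeight a p s ≠ 0 := fun p hp =>
    lineWeight_ne_zero (hS p hp) hs fun h => hsS (h ▸ hp)
  constructor
  · exact Finset.analyticAt_fun_prod _ fun p hp => (analyticAt_lineWeight a p s).zpow (hne p hp)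
  · exact Finset.prod_ne_zero_iff.2 fun p hp => zpow_ne_zero _ (hne p hp)

lemma meromorphic_lineWeightProd {a : ℝ} {S : Finset ℂ} {e : ℂ → ℤ} :
    Meromorphic (lineWeightProd a S e) := fun _ =>
  MeromorphicAt.fun_prod fun p _ => (analyticAt_lineWeight a p _).meromorphicAt.zpow _

lemma meromorphicOrderAt_lineWeightProd {a : ℝ} {S : Finset ℂ} {e : ℂ → ℤ}
    (hS : ∀ p ∈ S, a ≤ p.re) {p : ℂ} (hp : p ∈ S) :
    meromorphicOrderAt (lineWeightProd a S e) p
      = ((e p * (if p.re = a then 2 else 1) : ℤ) : WithTop ℤ) := by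
  have hfac : lineWeightProd a S e = (lineWeight a p ^ e p) * lineWeightProd a (S.erase p) e := by
    ext s
    exact (Finset.mul_prod_erase S (fun p => lineWeight a p s ^ e p) hp).symm
  obtain ⟨han, hne⟩ := analyticAt_lineWeightProd (e := e) (S := S.erase p)
    (fun q hq => hS q (Finset.mem_of_mem_erase hq)) (hS p hp) (Finset.notMem_erase p S)
  rw [hfac, meromorphicOrderAt_mul ((analyticAt_lineWeight a p p).meromorphicAt.zpow _)
    meromorphic_lineWeightProd.meromorphicAt, han.meromorphicNFAt.meromorphicOrderAt_eq_zero_iff.2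
    hne, add_zero, meromorphicOrderAt_zpow (analyticAt_lineWeight a p p).meromorphicAt,
    meromorphicOrderAt_lineWeight_self]
  split_ifs <;> push_cast <;> rfl

lemma lineWeightProd_of_re_eq {a : ℝ} {S : Finset ℂ} {e : ℂ → ℤ} {s : ℂ} (hs : s.re = a) :
    lineWeightProd a S e s = ((∏ p ∈ S, Complex.normSq (s - p) ^ e p : ℝ) : ℂ) := by
  rw [lineWeightProd]
  push_cast
  exact Finset.prod_congr rfl fun p _ => by rw [lineWeight_of_re_eq p hs]

/-- Each factor is comparable to `z²`, so the product is comparable to `z` raised to twice the sum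
of the exponents. -/
lemma exists_norm_lineWeightProd_le {a : ℝ} {S : Finset ℂ} {e : ℂ → ℤ}
    (he : ∑ p ∈ S, e p ≤ -1) :
    ∃ C ≥ 0, ∃ R, ∀ z : ℂ, R ≤ ‖z‖ → ‖lineWeightProd a S e z‖ ≤ C / ‖z‖ ^ 2 := by
  have h : lineWeightProd a S e =Θ[Bornology.cobounded ℂ]
      fun z => ∏ p ∈ S, ((z ^ 2) ^ e p : ℂ) :=
    Asymptotics.IsTheta.finsetProd fun p _ => (lineWeight_isTheta a p).zpow _
  obtain ⟨C, hC, hb⟩ := h.1.exists_nonneg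
  rw [Asymptotics.isBigOWith_iff, ← comap_norm_atTop, eventually_comap] at hb
  obtain ⟨R, hR⟩ := eventually_atTop.1 hb
  refine ⟨C, hC, max R 1, fun z hz => ?_⟩
  have h1 : 1 ≤ ‖z‖ := (le_max_right _ _).trans hz
  have hz0 : z ≠ 0 := norm_pos_iff.1 (by linarith)
  refine (hR ‖z‖ ((le_max_left _ _).trans hz) z rfl).trans ?_
  rw [div_eq_mul_inv]
  gcongr
  rw [norm_prod]
  simp only [norm_zpow, norm_pow]
  have hsum : ∀ T : Finset ℂ, ∏ p ∈ T, (‖z‖ ^ 2) ^ e p = (‖z‖ ^ 2) ^ ∑ p ∈ T, e p := fun T => by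
    classical
    induction T using Finset.induction with
    | empty => simp
    | insert p T hp ih => rw [Finset.prod_insert hp, Finset.sum_insert hp, ih,
        zpow_add₀ (by positivity)]
  rw [hsum, ← zpow_neg_one]
  exact zpow_le_zpow_right₀ (one_le_pow₀ h1) he

/-! ### The counting principle. -/

/-- The counting principle: if `g` is meromorphic, bounded near infinity on the closed half-plane
`σ ≥ a`, satisfies `|g - 1| ≤ 1` on the line `σ = a` and does not vanish identically, then any
weights `e` that compensate the zeros and poles of `g` have nonnegative sum. -/
theorem sum_compensating_weights_nonneg {a M R : ℝ} {g : ℂ → ℂ} {S : Finset ℂ} {e : ℂ → ℤ}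
    (hg : Meromorphic g) (hgtop : meromorphicOrderAt g (a : ℂ) ≠ ⊤)
    (hS : ∀ p ∈ S, a ≤ p.re)
    (hM : ∀ z : ℂ, a ≤ z.re → R ≤ ‖z‖ → ‖g z‖ ≤ M)
    (hline : ∀ z : ℂ, z.re = a → ‖g z - 1‖ ≤ 1)
    (hana : ∀ z : ℂ, a ≤ z.re → z ∉ S → AnalyticAt ℂ g z)
    (hin : ∀ p ∈ S, a < p.re → ((-e p : ℤ) : WithTop ℤ) ≤ meromorphicOrderAt g p)
    (hon : ∀ p ∈ S, p.re = a → ((-(2 * e p) : ℤ) : WithTop ℤ) ≤ meromorphicOrderAt g p) :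
    0 ≤ ∑ p ∈ S, e p := by
  by_contra hneg
  obtain ⟨C, hC, R', hCR⟩ := exists_norm_lineWeightProd_le (a := a)
    (show ∑ p ∈ S, e p ≤ -1 by omega)
  set W := lineWeightProd a S e with hW
  have hWm : Meromorphic W := meromorphic_lineWeightProd
  have hΨ : MeromorphicOn (g * W) Set.univ := fun z _ => (hg z).mul (hWm z)
  -- Passing to the normal form fills the removable singularities at the points of `S`, so
  -- holomorphy reduces to an inequality between orders.
  set Φ := toMeromorphicNFOn (g * W) Set.univ with hΦ
  have hval : ∀ z : ℂ, AnalyticAt ℂ (g * W) z → Φ z = g z * W z := fun z hz => by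
    rw [hΦ, toMeromorphicNFOn_eq_toMeromorphicNFAt hΨ (Set.mem_univ z),
      toMeromorphicNFAt_eq_self.2 hz.meromorphicNFAt]
    rfl
  have hanS : ∀ z : ℂ, a ≤ z.re → z ∉ S → AnalyticAt ℂ (g * W) z := fun z hz hzS =>
    (hana z hz hzS).mul (analyticAt_lineWeightProd hS hz hzS).1
  have hd : ∀ z : ℂ, a ≤ z.re → DifferentiableAt ℂ Φ z := by
    intro z hz
    refine AnalyticAt.differentiableAt ?_
    rw [← (meromorphicNFOn_toMeromorphicNFOn (g * W) Set.univ
      (Set.mem_univ z)).meromorphicOrderAt_nonneg_iff_analyticAt,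
      meromorphicOrderAt_toMeromorphicNFOn hΨ (Set.mem_univ z)]
    by_cases hzS : z ∈ S
    · rw [meromorphicOrderAt_mul (hg z) (hWm z), hW, meromorphicOrderAt_lineWeightProd hS hzS]
      cases hord : meromorphicOrderAt g z with
      | top => simp
      | coe n =>
        rw [← WithTop.coe_add, ← WithTop.coe_zero, WithTop.coe_le_coe]
        split_ifs with hre
        · have := hon z hzS hre
          rw [hord, WithTop.coe_le_coe] at this
          linarith
        · have := hin z hzS (lt_of_le_of_ne hz (Ne.symm hre))
          rw [hord, WithTop.coe_le_coe] at this
          linarith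
    · exact (hanS z hz hzS).meromorphicOrderAt_nonneg
  have hb : ∀ z : ℂ, a ≤ z.re → max (max R R') (1 + ∑ p ∈ S, ‖p‖) ≤ ‖z‖ →
      ‖Φ z‖ ≤ (|M| * C) / ‖z‖ ^ 2 := by
    intro z hz hzn
    have hzS : z ∉ S := fun h => by
      have h1 := Finset.single_le_sum (f := fun p : ℂ => ‖p‖) (fun _ _ => norm_nonneg _) h
      have h2 := (le_max_right _ _).trans hzn
      linarith
    rw [hval z (hanS z hz hzS), norm_mul, mul_div_assoc]
    have h1 : R ≤ ‖z‖ := ((le_max_left _ _).trans (le_max_left _ _)).trans hzn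
    have h2 : R' ≤ ‖z‖ := ((le_max_right _ _).trans (le_max_left _ _)).trans hzn
    exact mul_le_mul ((hM z hz h1).trans (le_abs_self _)) (hCR z h2) (norm_nonneg _) (abs_nonneg _)
  have hreg : ∀ z : ℂ, z.re = a → 0 ≤ (g z).re := fun z hz => by
    have h1 := (Complex.abs_re_le_norm (g z - 1)).trans (hline z hz)
    rw [Complex.sub_re, Complex.one_re, abs_le] at h1
    linarith
  have hre : ∀ z : ℂ, z.re = a → z ∉ S →
      (Φ z).re = (g z).re * ∏ p ∈ S, Complex.normSq (z - p) ^ e p := fun z hz hzS => by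
    rw [hval z (hanS z hz.ge hzS), hW, lineWeightProd_of_re_eq hz, Complex.re_mul_ofReal]
  have hprod : ∀ z : ℂ, z ∉ S → 0 < ∏ p ∈ S, Complex.normSq (z - p) ^ e p := fun z hzS => by
    refine Finset.prod_pos fun p hp => zpow_pos (Complex.normSq_pos.2 (sub_ne_zero.2 ?_)) _
    rintro rfl
    exact hzS hp
  have hinj : Function.Injective fun y : ℝ => (a : ℂ) + y * Complex.I := fun x y hxy => by
    simpa using congrArg Complex.im hxy
  have hcont : Continuous fun y : ℝ => (Φ (a + y * Complex.I)).re := by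
    refine Complex.continuous_re.comp (continuous_iff_continuousAt.2 fun y => ?_)
    exact ContinuousAt.comp (f := fun y : ℝ => (a : ℂ) + y * Complex.I) (g := Φ)
      (hd _ (by simp)).continuousAt (by fun_prop)
  -- The sign is known only off the finite set `S`; continuity of `Φ` extends it to the whole line.
  have hnn : ∀ y : ℝ, 0 ≤ (Φ (a + y * Complex.I)).re := by
    have hclosed : IsClosed {y : ℝ | 0 ≤ (Φ (a + y * Complex.I)).re} :=
      isClosed_le continuous_const hcont
    have hdense : Dense {y : ℝ | 0 ≤ (Φ (a + y * Complex.I)).re} := by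
      have hfin : ((fun y : ℝ => (a : ℂ) + y * Complex.I) ⁻¹' (S : Set ℂ)).Finite :=
        S.finite_toSet.preimage hinj.injOn
      refine (hfin.countable.dense_compl ℝ).mono fun y hy => ?_
      have hy' : (a : ℂ) + y * Complex.I ∉ S := hy
      rw [Set.mem_ofPred_eq, hre _ (by simp) hy']
      exact mul_nonneg (hreg _ (by simp)) (hprod _ hy').le
    intro y
    have : y ∈ closure {y : ℝ | 0 ≤ (Φ (a + y * Complex.I)).re} := hdense y
    rwa [hclosed.closure_eq] at this
  have hzero := re_eq_zero_on_line_of_isBigO hd hb (by positivity) hnn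
  have hgz : ∀ z : ℂ, z.re = a → z ∉ S → g z = 0 := by
    intro z hz hzS
    have hzz : z = a + (z.im : ℂ) * Complex.I := by
      rw [← hz, Complex.re_add_im]
    have h0 : (g z).re = 0 := by
      have := hzero z.im
      rw [← hzz, hre z hz hzS] at this
      exact (mul_eq_zero.1 this).resolve_right (hprod z hzS).ne'
    have h1 := hline z hz
    -- The imaginary axis touches the disc `|w - 1| ≤ 1` only at 0.
    have h2 : Complex.normSq (g z - 1) ≤ 1 := by
      rw [Complex.normSq_eq_norm_sq]
      exact pow_le_one₀ (norm_nonneg _) h1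
    rw [Complex.normSq_apply] at h2
    simp only [Complex.sub_re, h0, Complex.one_re, Complex.sub_im, Complex.one_im] at h2
    apply Complex.ext
    · exact h0
    · simp only [Complex.zero_im]
      nlinarith
  apply hgtop
  rw [meromorphicOrderAt_eq_top_iff]
  refine (hg (a : ℂ)).frequently_zero_iff_eventuallyEq_zero.1 ?_
  -- Zeros accumulate at `a` along the vertical line, so `g` vanishes identically near `a`.
  have htend : Tendsto (fun y : ℝ => (a : ℂ) + y * Complex.I) (𝓝[≠] 0) (𝓝[≠] (a : ℂ)) := by
    refine tendsto_nhdsWithin_iff.2 ⟨?_, ?_⟩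
    · have : ContinuousAt (fun y : ℝ => (a : ℂ) + y * Complex.I) 0 := by fun_prop
      have h := this.tendsto
      simp only [Complex.ofReal_zero, zero_mul, add_zero] at h
      exact h.mono_left nhdsWithin_le_nhds
    · filter_upwards [self_mem_nhdsWithin] with y hy h
      apply hy
      simpa using congrArg Complex.im h
  refine htend.frequently (Eventually.frequently ?_)
  have hS' : ∀ᶠ z in 𝓝[≠] (a : ℂ), z ∉ S := S.finite_toSet.eventually_nhdsNE_notMem _
  filter_upwards [htend.eventually hS'] with y hy using hgz _ (by simp) hy

/-! ### Both ends of the strip at once. -/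

/-- A two-sided version of `norm_le_on_half_strip`. -/
lemma exists_norm_le_on_strip_of_abs_im_ge {a σ₀ R₀ : ℝ} {G : ℂ → ℂ} (hσ : a < σ₀) (hR : 0 ≤ R₀)
    (hd : ∀ z : ℂ, a ≤ z.re → z.re ≤ σ₀ → R₀ ≤ |z.im| → DifferentiableAt ℂ G z)
    (hleft : ∀ z : ℂ, z.re = a → ‖G z‖ ≤ 1)
    (hright : ∀ z : ℂ, z.re = σ₀ → ‖G z‖ ≤ 1)
    (hgrow : ∀ δ > 0, ∃ t : ℕ → ℝ, Tendsto t atTop atTop ∧ ∀ (n : ℕ) (z : ℂ),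
      a ≤ z.re → z.re ≤ σ₀ → |z.im| = t n → ‖G z‖ ≤ Real.exp (δ * ‖z‖)) :
    ∃ M, ∀ z : ℂ, a ≤ z.re → z.re ≤ σ₀ → R₀ ≤ |z.im| → ‖G z‖ ≤ M := by
  have hseg : ∀ r : ℝ, |r| = R₀ → ∃ M, ∀ z : ℂ, a ≤ z.re → z.re ≤ σ₀ → z.im = r → ‖G z‖ ≤ M := by
    intro r hr
    have hK : IsCompact (Set.Icc a σ₀ ×ℂ ({r} : Set ℝ)) := isCompact_Icc.reProdIm isCompact_singleton
    obtain ⟨M, hM⟩ := hK.exists_bound_of_continuousOn (f := G) (by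
      intro z hz
      rw [Complex.mem_reProdIm] at hz
      refine (hd z hz.1.1 hz.1.2 ?_).continuousAt.continuousWithinAt
      rw [Set.mem_singleton_iff.1 hz.2, hr])
    exact ⟨M, fun z h1 h2 h3 => hM z (by rw [Complex.mem_reProdIm]; exact ⟨⟨h1, h2⟩, h3⟩)⟩
  obtain ⟨M₁, hM₁⟩ := hseg R₀ (abs_of_nonneg hR)
  obtain ⟨M₂, hM₂⟩ := hseg (-R₀) (by rw [abs_neg, abs_of_nonneg hR])
  set M := max 1 (max M₁ M₂)
  have hM : 1 ≤ M := le_max_left _ _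
  have h1M : M₁ ≤ M := (le_max_left _ _).trans (le_max_right _ _)
  have h2M : M₂ ≤ M := (le_max_right _ _).trans (le_max_right _ _)
  refine ⟨M, fun z h1 h2 h3 => ?_⟩
  rcases le_total 0 z.im with him | him
  · refine norm_le_on_half_strip hM hσ hR (fun z h1 h2 h3 => hd z h1 h2 (h3.trans (le_abs_self _)))
      (fun z h1 h2 h3 => (hM₁ z h1 h2 h3).trans h1M) (fun z h _ => (hleft z h).trans hM)
      (fun z h _ => (hright z h).trans hM) (fun δ hδ => ?_) h1 h2 (by rwa [abs_of_nonneg him] at h3)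
    obtain ⟨t, ht, hb⟩ := hgrow δ hδ
    -- Early terms of `t` may be negative; shifting past them gives `|t n| = t n`.
    obtain ⟨N, hN⟩ := eventually_atTop.1 (ht.eventually (eventually_ge_atTop 0))
    refine ⟨fun n => t (n + N), ht.comp (tendsto_add_atTop_nat N), fun n z h1 h2 h3 =>
      hb (n + N) z h1 h2 ?_⟩
    rw [h3, abs_of_nonneg (hN _ (by omega))]
  -- The lower end is the upper end for the function `conj ∘ G ∘ conj`.
  · have key := norm_le_on_half_strip (G := starRingEnd ℂ ∘ G ∘ starRingEnd ℂ) (s := starRingEnd ℂ z)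
      hM hσ hR
      (fun z h1 h2 h3 => by
        simpa using (hd (starRingEnd ℂ z) (by simpa) (by simpa) (by
          rw [Complex.conj_im, abs_neg]; exact h3.trans (le_abs_self _))).conj_conj)
      (fun z h1 h2 h3 => by
        simpa using (hM₂ (starRingEnd ℂ z) (by simpa) (by simpa) (by simpa)).trans h2M)
      (fun z h _ => by simpa using (hleft (starRingEnd ℂ z) (by simpa)).trans hM)
      (fun z h _ => by simpa using (hright (starRingEnd ℂ z) (by simpa)).trans hM) (fun δ hδ => ?_)
      (by simpa) (by simpa) (by rwa [abs_of_nonpos him] at h3)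
    · simpa using key
    obtain ⟨t, ht, hb⟩ := hgrow δ hδ
    obtain ⟨N, hN⟩ := eventually_atTop.1 (ht.eventually (eventually_ge_atTop 0))
    refine ⟨fun n => t (n + N), ht.comp (tendsto_add_atTop_nat N), fun n z h1 h2 h3 => ?_⟩
    have := hb (n + N) (starRingEnd ℂ z) (by simpa) (by simpa) (by
      rw [Complex.conj_im, abs_neg, h3, abs_of_nonneg (hN _ (by omega))])
    simpa using this

/-! ### Conjugation and reflection of meromorphic functions. -/

lemma AnalyticAt.conj_conj {g : ℂ → ℂ} {s : ℂ} (hg : AnalyticAt ℂ g (starRingEnd ℂ s)) :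
    AnalyticAt ℂ (fun z => starRingEnd ℂ (g (starRingEnd ℂ z))) s := by
  rw [Complex.analyticAt_iff_eventually_differentiableAt] at hg ⊢
  have h := (Complex.continuous_conj.tendsto s).eventually hg
  filter_upwards [h] with z hz
  simpa [Function.comp_def] using hz.conj_conj

lemma tendsto_conj_nhdsNE (s : ℂ) :
    Tendsto (starRingEnd ℂ) (𝓝[≠] s) (𝓝[≠] (starRingEnd ℂ s)) :=
  tendsto_nhdsWithin_iff.2 ⟨(Complex.continuous_conj.tendsto s).mono_left nhdsWithin_le_nhds,
    eventually_nhdsWithin_of_forall fun _ hz h => hz ((starRingEnd ℂ).injective h)⟩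

lemma tendsto_const_sub_nhdsNE (c s : ℂ) :
    Tendsto (fun z => c - z) (𝓝[≠] s) (𝓝[≠] (c - s)) :=
  tendsto_nhdsWithin_iff.2 ⟨((continuous_const.sub continuous_id).tendsto s).mono_left
    nhdsWithin_le_nhds, eventually_nhdsWithin_of_forall fun _ hz h => hz (sub_right_injective h)⟩

lemma MeromorphicAt.conj_conj {g : ℂ → ℂ} {s : ℂ} (hg : MeromorphicAt g (starRingEnd ℂ s)) :
    MeromorphicAt (fun z => starRingEnd ℂ (g (starRingEnd ℂ z))) s := by
  obtain ⟨n, hn⟩ := hg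
  refine ⟨n, hn.conj_conj.congr (Eventually.of_forall fun z => ?_)⟩
  simp

lemma meromorphicOrderAt_conj_conj {g : ℂ → ℂ} {s : ℂ} (hg : MeromorphicAt g (starRingEnd ℂ s)) :
    meromorphicOrderAt (fun z => starRingEnd ℂ (g (starRingEnd ℂ z))) s
      = meromorphicOrderAt g (starRingEnd ℂ s) := by
  cases hord : meromorphicOrderAt g (starRingEnd ℂ s) with
  | top =>
    rw [meromorphicOrderAt_eq_top_iff] at hord ⊢
    filter_upwards [(tendsto_conj_nhdsNE s).eventually hord] with z hz
    simp [hz]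
  | coe n =>
    rw [meromorphicOrderAt_eq_int_iff hg] at hord
    obtain ⟨u, hu, hu0, hev⟩ := hord
    rw [meromorphicOrderAt_eq_int_iff hg.conj_conj]
    refine ⟨_, hu.conj_conj, by simpa using hu0, ?_⟩
    filter_upwards [(tendsto_conj_nhdsNE s).eventually hev] with z hz
    simp [hz]

lemma meromorphicOrderAt_comp_const_sub (h : ℂ → ℂ) (c s : ℂ) :
    meromorphicOrderAt (fun z => h (c - z)) s = meromorphicOrderAt h (c - s) :=
  meromorphicOrderAt_comp_of_deriv_ne_zero (f := h) (g := fun z => c - z) (by fun_prop)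
    (by simp)

lemma Meromorphic.comp_const_sub {h : ℂ → ℂ} (hh : Meromorphic h) (c : ℂ) :
    Meromorphic fun z => h (c - z) := fun s =>
  MeromorphicAt.comp_analyticAt (f := h) (g := fun z => c - z) (hh _) (by fun_prop)

lemma meroValue_of_analyticAt {m : ℂ → ℂ} {s : ℂ} (hm : AnalyticAt ℂ m s) : meroValue m s = m s := by
  rw [meroValue, toMeromorphicNFAt_eq_self.2 hm.meromorphicNFAt]

/-- A meromorphic function that is real on the real axis commutes with conjugation. -/
lemma RealOnRealAxis.conj_conj_eventuallyEq {h : ℂ → ℂ} (hh : Meromorphic h)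
    (hreal : RealOnRealAxis h) (s : ℂ) :
    (fun z => starRingEnd ℂ (h (starRingEnd ℂ z))) =ᶠ[𝓝[≠] s] h := by
  set k : ℂ → ℂ := fun z => starRingEnd ℂ (h (starRingEnd ℂ z))
  have hk : Meromorphic k := fun z => (hh _).conj_conj
  have h0 : k =ᶠ[𝓝[≠] 0] h := by
    refine ((hk 0).frequently_eq_iff_eventuallyEq (hh 0)).1 ?_
    have htend : Tendsto (fun x : ℝ => (x : ℂ)) (𝓝[≠] 0) (𝓝[≠] 0) := by
      refine tendsto_nhdsWithin_iff.2 ⟨?_, ?_⟩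
      · exact (Complex.continuous_ofReal.tendsto' 0 0 (by simp)).mono_left nhdsWithin_le_nhds
      · filter_upwards [self_mem_nhdsWithin] with y hy h
        exact hy (by simpa using h)
    refine htend.frequently (Eventually.frequently ?_)
    filter_upwards [htend.eventually (hh 0).eventually_analyticAt] with x hx
    have him := hreal x (not_lt.2 hx.meromorphicOrderAt_nonneg)
    rw [meroValue_of_analyticAt hx] at him
    simp only [k, Complex.conj_ofReal]
    exact Complex.conj_eq_iff_im.2 him
  -- Identity theorem: infinite order of `k - h` at 0 propagates to all of `ℂ`.
  have htop : ∀ z, meromorphicOrderAt (k - h) z = ⊤ := by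
    by_contra! hex
    refine (hk.sub hh).exists_meromorphicOrderAt_ne_top_iff_forall.1 hex 0 ?_
    rw [meromorphicOrderAt_eq_top_iff]
    filter_upwards [h0] with z hz using sub_eq_zero.2 hz
  filter_upwards [meromorphicOrderAt_eq_top_iff.1 (htop s)] with z hz using sub_eq_zero.1 hz

/-! ### The quotient `F`: poles, modulus on the line, boundedness. -/

lemma meromorphic_reflQuot {h : ℂ → ℂ} (hh : Meromorphic h) (a : ℝ) : Meromorphic (reflQuot h a) :=
  (hh.comp_const_sub _).div hh

lemma meromorphic_symComb {h : ℂ → ℂ} (hh : Meromorphic h) (a : ℝ) (ε : ℤˣ) :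
    Meromorphic (symComb h a ε) := fun s =>
  (hh s).add ((MeromorphicAt.const _ s).mul (hh.comp_const_sub _ s))

lemma meromorphicOrderAt_reflQuot {h : ℂ → ℂ} (hh : Meromorphic h) (a : ℝ) (s : ℂ) :
    meromorphicOrderAt (reflQuot h a) s
      = meromorphicOrderAt h (2 * (a : ℂ) - s) + -meromorphicOrderAt h s := by
  have : reflQuot h a = (fun z => h (2 * (a : ℂ) - z)) * h⁻¹ := by
    ext z; simp [reflQuot, div_eq_mul_inv]
  rw [this, meromorphicOrderAt_mul (hh.comp_const_sub _ s) (hh s).inv,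
    meromorphicOrderAt_comp_const_sub, meromorphicOrderAt_inv]

/-- The quotient `F(s) = h(2a - s) / h(s)` with its removable singularities filled in. -/
noncomputable def reflQuotNF (h : ℂ → ℂ) (a : ℝ) : ℂ → ℂ :=
  toMeromorphicNFOn (reflQuot h a) Set.univ

lemma reflQuotNF_eq_meroValue {h : ℂ → ℂ} (hh : Meromorphic h) (a : ℝ) (s : ℂ) :
    reflQuotNF h a s = meroValue (reflQuot h a) s :=
  toMeromorphicNFOn_eq_toMeromorphicNFAt (meromorphic_reflQuot hh a).meromorphicOn (Set.mem_univ s)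

lemma reflQuotNF_eventuallyEq {h : ℂ → ℂ} (hh : Meromorphic h) (a : ℝ) (s : ℂ) :
    reflQuotNF h a =ᶠ[𝓝[≠] s] reflQuot h a :=
  (meromorphic_reflQuot hh a).meromorphicOn.toMeromorphicNFOn_eq_self_on_nhdsNE (Set.mem_univ s)

lemma meromorphic_reflQuotNF (h : ℂ → ℂ) (a : ℝ) : Meromorphic (reflQuotNF h a) := fun s =>
  (meromorphicNFOn_toMeromorphicNFOn _ _ (Set.mem_univ s)).meromorphicAt

lemma analyticAt_reflQuotNF {h : ℂ → ℂ} (hh : Meromorphic h) {a : ℝ} {s : ℂ}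
    (hs : ¬ IsPoleAt (reflQuot h a) s) : AnalyticAt ℂ (reflQuotNF h a) s := by
  rw [reflQuotNF, ← (meromorphicNFOn_toMeromorphicNFOn _ _
    (Set.mem_univ s)).meromorphicOrderAt_nonneg_iff_analyticAt,
    meromorphicOrderAt_toMeromorphicNFOn (meromorphic_reflQuot hh a).meromorphicOn (Set.mem_univ s)]
  exact not_lt.1 hs

lemma two_mul_sub_re_of_re_eq {a : ℝ} {s : ℂ} (hs : s.re = a) :
    2 * (a : ℂ) - s = starRingEnd ℂ s := by
  subst hs
  apply Complex.ext <;> simp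
  ring

lemma order_ne_top_of_line {a : ℝ} {h : ℂ → ℂ} (hh : Meromorphic h)
    (hline : ∀ s : ℂ, s.re = a → meromorphicOrderAt h s = 0)
    (s : ℂ) : meromorphicOrderAt h s ≠ ⊤ :=
  hh.exists_meromorphicOrderAt_ne_top_iff_forall.1 ⟨a, by simp [hline a]⟩ s

lemma not_isPoleAt_reflQuot_of_re_eq {a : ℝ} {h : ℂ → ℂ} (hh : Meromorphic h)
    (hline : ∀ s : ℂ, s.re = a → meromorphicOrderAt h s = 0)
    {s : ℂ} (hs : s.re = a) : ¬ IsPoleAt (reflQuot h a) s := by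
  rw [IsPoleAt, meromorphicOrderAt_reflQuot hh, hline s hs,
    hline _ (by rw [two_mul_sub_re_of_re_eq hs]; simpa)]
  simp

/-- On the line `2a - s` is the conjugate of `s`, so numerator and denominator of `F` have equal
modulus. The identities used hold only on punctured neighbourhoods, so the value at `s` is reached
as a limit along the line. The form `≤ 1` also covers the convention `0 / 0 = 0`. -/
lemma norm_reflQuotNF_le_one {a : ℝ} {h : ℂ → ℂ} (hh : Meromorphic h)
    (hline : ∀ s : ℂ, s.re = a → meromorphicOrderAt h s = 0)
    (hreal : RealOnRealAxis h) {s : ℂ} (hs : s.re = a) :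
    ‖reflQuotNF h a s‖ ≤ 1 := by
  have htend : Tendsto (fun y : ℝ => s + y * Complex.I) (𝓝[≠] 0) (𝓝[≠] s) := by
    refine tendsto_nhdsWithin_iff.2 ⟨?_, ?_⟩
    · have : ContinuousAt (fun y : ℝ => s + y * Complex.I) 0 := by fun_prop
      have h := this.tendsto
      simp only [Complex.ofReal_zero, zero_mul, add_zero] at h
      exact h.mono_left nhdsWithin_le_nhds
    · filter_upwards [self_mem_nhdsWithin] with y hy h
      apply hy
      simpa using h
  have hcont := (analyticAt_reflQuotNF hh
    (not_isPoleAt_reflQuot_of_re_eq hh hline hs)).continuousAt.norm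
  refine le_of_tendsto (hcont.tendsto.comp (htend.mono_right nhdsWithin_le_nhds)) ?_
  filter_upwards [htend.eventually (reflQuotNF_eventuallyEq hh a s),
    htend.eventually (hreal.conj_conj_eventuallyEq hh s)] with y h1 h2
  simp only [Function.comp_apply]
  rw [h1, reflQuot, two_mul_sub_re_of_re_eq (by simpa), norm_div, ← h2, Complex.norm_conj]
  exact div_self_le_one _

/-- A pole of `F` at `s` requires a zero of `h` at `s` or a pole of `h` at `2a - s`. -/
lemma finite_poles_reflQuot {a : ℝ} {h : ℂ → ℂ} (hh : Meromorphic h)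
    (hline : ∀ s : ℂ, s.re = a → meromorphicOrderAt h s = 0)
    (hpoles : {s | IsPoleAt h s}.Finite)
    (hzeros : {s | s ∈ rightHalfPlane a ∧ IsZeroAt h s}.Finite) :
    {s | s ∈ rightHalfPlane a ∧ IsPoleAt (reflQuot h a) s}.Finite := by
  refine (hzeros.union (hpoles.image fun z => 2 * (a : ℂ) - z)).subset ?_
  rintro s ⟨hs, hp⟩
  by_cases hz : IsZeroAt h s
  · exact Or.inl ⟨hs, hz⟩
  right
  refine ⟨2 * (a : ℂ) - s, ?_, by simp⟩
  rw [IsPoleAt, meromorphicOrderAt_reflQuot hh] at hp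
  rw [IsZeroAt] at hz
  rw [Set.mem_ofPred_eq, IsPoleAt]
  have t1 := order_ne_top_of_line hh hline s
  have t2 := order_ne_top_of_line hh hline (2 * (a : ℂ) - s)
  lift meromorphicOrderAt h s to ℤ using t1 with m
  lift meromorphicOrderAt h (2 * (a : ℂ) - s) to ℤ using t2 with n
  norm_cast at *
  omega

lemma exists_norm_reflQuotNF_le {a : ℝ} {h : ℂ → ℂ} (hh : Meromorphic h)
    (hline : ∀ s : ℂ, s.re = a → meromorphicOrderAt h s = 0)
    (hreal : RealOnRealAxis h) (hpoles : {s | IsPoleAt h s}.Finite)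
    (hzeros : {s | s ∈ rightHalfPlane a ∧ IsZeroAt h s}.Finite)
    (hF_right : ∀ η > 0, ∃ σ₀ > a, ∀ s : ℂ, σ₀ ≤ s.re → NormLtAt (reflQuot h a) s η)
    (hF_horiz : ∀ δ > 0, ∀ σ₀ > a, ∃ t : ℕ → ℝ, Tendsto t atTop atTop ∧
      ∀ (n : ℕ) (s : ℂ), a ≤ s.re → s.re ≤ σ₀ → |s.im| = t n →
        NormLtAt (reflQuot h a) s (Real.exp (δ * ‖s‖))) :
    ∃ M R : ℝ, ∀ z : ℂ, a ≤ z.re → R ≤ ‖z‖ → ‖reflQuotNF h a z‖ ≤ M := by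
  obtain ⟨σ₀, hσ, hr⟩ := hF_right 1 one_pos
  have hr' : ∀ z : ℂ, σ₀ ≤ z.re → ‖reflQuotNF h a z‖ ≤ 1 := fun z hz => by
    rw [reflQuotNF_eq_meroValue hh]
    exact (hr z hz).2.le
  obtain ⟨R₀, hR₀⟩ := (finite_poles_reflQuot hh hline hpoles hzeros).isBounded.exists_norm_le
  set R₁ := max 0 R₀ + 1
  have hR₁ : 0 ≤ R₁ := by positivity
  obtain ⟨M, hM⟩ := exists_norm_le_on_strip_of_abs_im_ge (G := reflQuotNF h a) hσ hR₁
    (fun z h1 h2 h3 => by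
      refine (analyticAt_reflQuotNF hh ?_).differentiableAt
      rcases eq_or_lt_of_le h1 with h1 | h1
      · exact not_isPoleAt_reflQuot_of_re_eq hh hline h1.symm
      · intro hp
        have := hR₀ z ⟨h1, hp⟩
        have := Complex.abs_im_le_norm z
        have := le_max_right 0 R₀
        linarith)
    (fun z hz => norm_reflQuotNF_le_one hh hline hreal hz) (fun z hz => hr' z hz.ge)
    (fun δ hδ => by
      obtain ⟨t, ht, hb⟩ := hF_horiz δ hδ σ₀ hσ
      refine ⟨t, ht, fun n z h1 h2 h3 => ?_⟩
      rw [reflQuotNF_eq_meroValue hh]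
      exact (hb n z h1 h2 h3).2.le)
  -- In the strip `|Re z| ≤ |a| + |σ₀|`, so this radius forces `|Im z| ≥ R₁`, beyond all poles of
  -- `F` with `σ > a`.
  refine ⟨max M 1, |a| + |σ₀| + R₁, fun z h1 h2 => ?_⟩
  rcases le_total σ₀ z.re with h3 | h3
  · exact (hr' z h3).trans (le_max_right _ _)
  · refine (hM z h1 h3 ?_).trans (le_max_left _ _)
    have := Complex.norm_le_abs_re_add_abs_im z
    have : |z.re| ≤ |a| + |σ₀| :=
      (abs_le_max_abs_abs h1 h3).trans (max_le_add_of_nonneg (abs_nonneg _) (abs_nonneg _))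
    linarith

/-! ### Multiplicities and the factorisation `f = h·(1 ± F)`. -/

lemma norm_unit_intCast (ε : ℤˣ) : ‖((ε : ℤ) : ℂ)‖ = 1 := by
  rcases Int.units_eq_one_or ε with rfl | rfl <;> simp

lemma unit_intCast_mul_self (ε : ℤˣ) : ((ε : ℤ) : ℂ) * ((ε : ℤ) : ℂ) = 1 := by
  rcases Int.units_eq_one_or ε with rfl | rfl <;> simp

lemma untop₀_eq_zeroMult_sub_poleMult (m : ℂ → ℂ) (s : ℂ) :
    (meromorphicOrderAt m s).untop₀ = (zeroMult m s : ℤ) - poleMult m s := by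
  rw [zeroMult, poleMult]
  omega

/-- Finite order is needed: `untop₀` sends `⊤` to 0, although order `⊤` counts as a zero. -/
lemma zeroMult_eq_zero_iff {m : ℂ → ℂ} {s : ℂ} (hm : meromorphicOrderAt m s ≠ ⊤) :
    zeroMult m s = 0 ↔ ¬ IsZeroAt m s := by
  rw [zeroMult, IsZeroAt]
  lift meromorphicOrderAt m s to ℤ using hm with n
  norm_cast
  simp

lemma poleMult_eq_zero_iff {m : ℂ → ℂ} {s : ℂ} : poleMult m s = 0 ↔ ¬ IsPoleAt m s := by
  rw [poleMult, IsPoleAt]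
  cases meromorphicOrderAt m s with
  | top => simp
  | coe n => norm_cast; simp

lemma zeroMult_congr {m : ℂ → ℂ} {s t : ℂ} (h : meromorphicOrderAt m s = meromorphicOrderAt m t) :
    zeroMult m s = zeroMult m t := by
  rw [zeroMult, zeroMult, h]

lemma finsum_mem_eq_sum_ite {α M : Type*} [AddCommMonoid M] (f : α → M) (A : Set α) (Q : Finset α)
    [DecidablePred (· ∈ A)] (hQ : ∀ x ∈ A, f x ≠ 0 → x ∈ Q) :
    ∑ᶠ x ∈ A, f x = ∑ x ∈ Q, if x ∈ A then f x else 0 := by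
  rw [← Finset.sum_filter]
  refine finsum_mem_eq_sum_of_inter_support_eq f ?_
  ext x
  simp only [Set.mem_inter_iff, Function.mem_support, Finset.coe_filter, Set.mem_ofPred_eq]
  exact ⟨fun ⟨h1, h2⟩ => ⟨⟨hQ x h1 h2, h1⟩, h2⟩, fun ⟨⟨_, h1⟩, h2⟩ => ⟨h1, h2⟩⟩

/-- The function `1 ± F`, with removable singularities filled in. -/
noncomputable def onePlusReflQuot (h : ℂ → ℂ) (a : ℝ) (ε : ℤˣ) (s : ℂ) : ℂ :=
  1 + ((ε : ℤ) : ℂ) * reflQuotNF h a s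

lemma meromorphic_onePlusReflQuot (h : ℂ → ℂ) (a : ℝ) (ε : ℤˣ) :
    Meromorphic (onePlusReflQuot h a ε) := fun s =>
  (MeromorphicAt.const _ s).add ((MeromorphicAt.const _ s).mul (meromorphic_reflQuotNF h a s))

lemma analyticAt_onePlusReflQuot {h : ℂ → ℂ} (hh : Meromorphic h) {a : ℝ} (ε : ℤˣ) {s : ℂ}
    (hs : ¬ IsPoleAt (reflQuot h a) s) : AnalyticAt ℂ (onePlusReflQuot h a ε) s :=
  analyticAt_const.add (analyticAt_const.mul (analyticAt_reflQuotNF hh hs))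

lemma meromorphicOrderAt_symComb {h : ℂ → ℂ} (hh : Meromorphic h) (a : ℝ) (ε : ℤˣ) {s : ℂ}
    (hs : meromorphicOrderAt h s ≠ ⊤) :
    meromorphicOrderAt (symComb h a ε) s
      = meromorphicOrderAt h s + meromorphicOrderAt (onePlusReflQuot h a ε) s := by
  rw [← meromorphicOrderAt_mul (hh s) (meromorphic_onePlusReflQuot h a ε s)]
  refine meromorphicOrderAt_congr ?_
  filter_upwards [reflQuotNF_eventuallyEq hh a s,
    (meromorphicOrderAt_ne_top_iff_eventually_ne_zero (hh s)).1 hs] with z h1 h2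
  rw [Pi.mul_apply, onePlusReflQuot, h1, reflQuot, symComb]
  field_simp

/-- Far to the right `|F| < 1`, which excludes `1 ± F = 0` at one point; the identity theorem does
the rest. -/
lemma onePlusReflQuot_order_ne_top {h : ℂ → ℂ} (hh : Meromorphic h) {a : ℝ} (ε : ℤˣ)
    (hF_right : ∀ η > 0, ∃ σ₀ > a, ∀ s : ℂ, σ₀ ≤ s.re → NormLtAt (reflQuot h a) s η) (s : ℂ) :
    meromorphicOrderAt (onePlusReflQuot h a ε) s ≠ ⊤ := by
  obtain ⟨σ₀, -, hr⟩ := hF_right 1 one_pos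
  refine (meromorphic_onePlusReflQuot h a ε).exists_meromorphicOrderAt_ne_top_iff_forall.1
    ⟨σ₀, ?_⟩ s
  obtain ⟨h1, h2⟩ := hr σ₀ (by simp)
  rw [← reflQuotNF_eq_meroValue hh] at h2
  have hne : onePlusReflQuot h a ε σ₀ ≠ 0 := fun h0 => by
    rw [onePlusReflQuot, add_eq_zero_iff_eq_neg] at h0
    have := congrArg norm h0
    rw [norm_neg, norm_mul, norm_unit_intCast, one_mul, norm_one] at this
    linarith
  rw [(analyticAt_onePlusReflQuot hh ε h1).meromorphicNFAt.meromorphicOrderAt_eq_zero_iff.2 hne]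
  exact WithTop.zero_ne_top

/-! ### The weighted bound for the zeros of `f`. -/

/-- The hypotheses on `h` in the zero-counting theorem. -/
structure ReflectionAdmissible (h : ℂ → ℂ) (a : ℝ) : Prop where
  mero : Meromorphic h
  real : RealOnRealAxis h
  poles : {s | IsPoleAt h s}.Finite
  zeros : {s | s ∈ rightHalfPlane a ∧ IsZeroAt h s}.Finite
  line : ∀ s : ℂ, s.re = a → meromorphicOrderAt h s = 0
  right : ∀ η > 0, ∃ σ₀ > a, ∀ s : ℂ, σ₀ ≤ s.re → NormLtAt (reflQuot h a) s η
  horiz : ∀ δ > 0, ∀ σ₀ > a, ∃ t : ℕ → ℝ, Tendsto t atTop atTop ∧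
      ∀ (n : ℕ) (s : ℂ), a ≤ s.re → s.re ≤ σ₀ → |s.im| = t n →
        NormLtAt (reflQuot h a) s (Real.exp (δ * ‖s‖))

namespace ReflectionAdmissible

variable {h : ℂ → ℂ} {a : ℝ}

lemma order_ne_top (H : ReflectionAdmissible h a) (s : ℂ) : meromorphicOrderAt h s ≠ ⊤ :=
  order_ne_top_of_line H.mero H.line s

lemma order_symComb_ne_top (H : ReflectionAdmissible h a) (ε : ℤˣ) (s : ℂ) :
    meromorphicOrderAt (symComb h a ε) s ≠ ⊤ := by
  rw [meromorphicOrderAt_symComb H.mero a ε (H.order_ne_top s)]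
  exact WithTop.add_ne_top.2 ⟨H.order_ne_top s, onePlusReflQuot_order_ne_top H.mero ε H.right s⟩

lemma order_symComb_of_re_eq (H : ReflectionAdmissible h a) (ε : ℤˣ) {s : ℂ} (hs : s.re = a) :
    meromorphicOrderAt (symComb h a ε) s = meromorphicOrderAt (onePlusReflQuot h a ε) s := by
  rw [meromorphicOrderAt_symComb H.mero a ε (H.order_ne_top s), H.line s hs, zero_add]

lemma order_symComb_nonneg_of_re_eq (H : ReflectionAdmissible h a) (ε : ℤˣ) {s : ℂ}
    (hs : s.re = a) : 0 ≤ meromorphicOrderAt (symComb h a ε) s := by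
  rw [H.order_symComb_of_re_eq ε hs]
  exact (analyticAt_onePlusReflQuot H.mero ε
    (not_isPoleAt_reflQuot_of_re_eq H.mero H.line hs)).meromorphicOrderAt_nonneg

lemma order_symComb_eq_zeroMult (H : ReflectionAdmissible h a) (ε : ℤˣ) {s : ℂ}
    (hs : s.re = a) : meromorphicOrderAt (symComb h a ε) s
      = ((zeroMult (symComb h a ε) s : ℤ) : WithTop ℤ) := by
  have h1 := H.order_symComb_nonneg_of_re_eq ε hs
  have h2 := H.order_symComb_ne_top ε s
  rw [zeroMult]
  lift meromorphicOrderAt (symComb h a ε) s to ℤ using h2 with n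
  norm_cast at h1 ⊢
  simp [h1]

/-- For `σ > a` the weight is `-ord (1 ± F)`, by the factorisation of `f`. On the line `h` has order
0, and a zero of multiplicity `m` allows `⌊m/2⌋` double factors to be divided out. -/
lemma weights_sum_nonneg (H : ReflectionAdmissible h a) (ε : ℤˣ) (Z : Finset ℂ)
    (hZ : ∀ p ∈ Z, a ≤ p.re) (hZF : ∀ p : ℂ, a < p.re → IsPoleAt (reflQuot h a) p → p ∈ Z) :
    0 ≤ ∑ p ∈ Z, if a < p.re then
        (meromorphicOrderAt h p).untop₀ - (meromorphicOrderAt (symComb h a ε) p).untop₀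
      else -((zeroMult (symComb h a ε) p / 2 : ℕ) : ℤ) := by
  obtain ⟨M, R, hMR⟩ := exists_norm_reflQuotNF_le H.mero H.line H.real H.poles H.zeros H.right H.horiz
  refine sum_compensating_weights_nonneg (a := a) (M := 1 + M) (R := R)
    (g := onePlusReflQuot h a ε) (meromorphic_onePlusReflQuot h a ε)
    (onePlusReflQuot_order_ne_top H.mero ε H.right a) hZ ?_ ?_ ?_ ?_ ?_
  · intro z h1 h2
    rw [onePlusReflQuot]
    refine (norm_add_le _ _).trans ?_
    rw [norm_mul, norm_unit_intCast, one_mul, norm_one]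
    gcongr
    exact hMR z h1 h2
  · intro z hz
    rw [onePlusReflQuot, add_sub_cancel_left, norm_mul, norm_unit_intCast, one_mul]
    exact norm_reflQuotNF_le_one H.mero H.line H.real hz
  · intro z hz hzZ
    refine analyticAt_onePlusReflQuot H.mero ε fun hp => ?_
    rcases eq_or_lt_of_le hz with h1 | h1
    · exact not_isPoleAt_reflQuot_of_re_eq H.mero H.line h1.symm hp
    · exact hzZ (hZF z h1 hp)
  · intro p _ hp
    have h1 := meromorphicOrderAt_symComb H.mero a ε (H.order_ne_top p)
    have h2 := H.order_ne_top p
    have h3 := onePlusReflQuot_order_ne_top H.mero ε H.right p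
    rw [if_pos hp, h1]
    lift meromorphicOrderAt h p to ℤ using h2 with m
    lift meromorphicOrderAt (onePlusReflQuot h a ε) p to ℤ using h3 with n
    norm_cast
    simp
  · intro p _ hp
    rw [if_neg (by linarith), ← H.order_symComb_of_re_eq ε hp, H.order_symComb_eq_zeroMult ε hp]
    norm_cast
    omega

/-- The multiplicity of a zero of `f` with `σ > a`, and half of it (rounded down) if `σ = a`. -/
noncomputable def zeroWeight (h : ℂ → ℂ) (a : ℝ) (ε : ℤˣ) (s : ℂ) : ℕ :=
  if a < s.re then zeroMult (symComb h a ε) s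
  else if s.re = a then zeroMult (symComb h a ε) s / 2 else 0

lemma finite_poles_symComb (H : ReflectionAdmissible h a) (ε : ℤˣ) :
    {s | s ∈ rightHalfPlane a ∧ IsPoleAt (symComb h a ε) s}.Finite := by
  refine (H.poles.union (H.poles.image fun z => 2 * (a : ℂ) - z)).subset ?_
  rintro s ⟨-, hp⟩
  by_contra hcon
  simp only [Set.mem_union, Set.mem_image, Set.mem_ofPred_eq, not_or, not_exists, not_and] at hcon
  obtain ⟨h1, h2⟩ := hcon
  have h3 : ¬ IsPoleAt h (2 * (a : ℂ) - s) := fun hp => h2 _ hp (by ring)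
  have h4 : meromorphicOrderAt (fun z => ((ε : ℤ) : ℂ) * h (2 * (a : ℂ) - z)) s
      = meromorphicOrderAt h (2 * (a : ℂ) - s) := by
    rw [← meromorphicOrderAt_comp_const_sub]
    exact meromorphicOrderAt_mul_of_ne_zero (g := fun _ => ((ε : ℤ) : ℂ)) analyticAt_const
      (fun h0 => by simpa [h0] using norm_unit_intCast ε)
  have h5 := meromorphicOrderAt_add (H.mero s)
    ((MeromorphicAt.const ((ε : ℤ) : ℂ) s).mul (H.mero.comp_const_sub (2 * (a : ℂ)) s))
  refine (lt_of_lt_of_le hp ?_).not_ge h5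
  refine le_min (not_lt.1 h1) ?_
  exact (not_lt.1 h3).trans_eq h4.symm

/-- `Y` is enlarged to contain every pole of `f`, `h`, `F` and every zero of `h` with `σ > a`.
Splitting each order into zero and pole multiplicities then produces the full counts. -/
lemma sum_zeroWeight_le (H : ReflectionAdmissible h a) (ε : ℤˣ) (Y : Finset ℂ)
    (hY : ∀ p ∈ Y, a ≤ p.re) :
    ((∑ p ∈ Y, zeroWeight h a ε p : ℕ) : ℤ) ≤ poleCount (symComb h a ε) (rightHalfPlane a)
      + zeroCount h (rightHalfPlane a) - poleCount h (rightHalfPlane a) := by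
  classical
  have f1 := H.finite_poles_symComb ε
  have f2 := H.zeros
  have f3 : {s | s ∈ rightHalfPlane a ∧ IsPoleAt h s}.Finite := H.poles.subset fun s hs => hs.2
  have f4 := finite_poles_reflQuot H.mero H.line H.poles H.zeros
  set Z := f1.toFinset ∪ f2.toFinset ∪ f3.toFinset ∪ f4.toFinset ∪ Y with hZdef
  have hZmem : ∀ p, p ∈ Z ↔ ((((p ∈ rightHalfPlane a ∧ IsPoleAt (symComb h a ε) p) ∨
      (p ∈ rightHalfPlane a ∧ IsZeroAt h p)) ∨ (p ∈ rightHalfPlane a ∧ IsPoleAt h p)) ∨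
      (p ∈ rightHalfPlane a ∧ IsPoleAt (reflQuot h a) p)) ∨ p ∈ Y := by
    intro p
    simp only [hZdef, Finset.mem_union, Set.Finite.mem_toFinset, Set.mem_ofPred_eq]
  have hZ : ∀ p ∈ Z, a ≤ p.re := by
    intro p hp
    rw [hZmem] at hp
    rcases hp with (((hp | hp) | hp) | hp) | hp
    · exact le_of_lt hp.1
    · exact le_of_lt hp.1
    · exact le_of_lt hp.1
    · exact le_of_lt hp.1
    · exact hY p hp
  have key := H.weights_sum_nonneg ε Z hZ
    (fun p h1 h2 => (hZmem p).2 (Or.inl (Or.inr ⟨h1, h2⟩)))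
  have e1 : poleCount (symComb h a ε) (rightHalfPlane a) = ∑ p ∈ Z,
      if p ∈ rightHalfPlane a then poleMult (symComb h a ε) p else 0 :=
    finsum_mem_eq_sum_ite _ _ _ fun p h1 h2 => (hZmem p).2 (Or.inl (Or.inl (Or.inl (Or.inl
      ⟨h1, not_not.1 (mt poleMult_eq_zero_iff.2 h2)⟩))))
  have e2 : zeroCount h (rightHalfPlane a) = ∑ p ∈ Z,
      if p ∈ rightHalfPlane a then zeroMult h p else 0 :=
    finsum_mem_eq_sum_ite _ _ _ fun p h1 h2 => (hZmem p).2 (Or.inl (Or.inl (Or.inl (Or.inr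
      ⟨h1, not_not.1 (mt (zeroMult_eq_zero_iff (H.order_ne_top p)).2 h2)⟩))))
  have e3 : poleCount h (rightHalfPlane a) = ∑ p ∈ Z,
      if p ∈ rightHalfPlane a then poleMult h p else 0 :=
    finsum_mem_eq_sum_ite _ _ _ fun p h1 h2 => (hZmem p).2 (Or.inl (Or.inl (Or.inr
      ⟨h1, not_not.1 (mt poleMult_eq_zero_iff.2 h2)⟩)))
  have hYZ : ∑ p ∈ Y, zeroWeight h a ε p ≤ ∑ p ∈ Z, zeroWeight h a ε p :=
    Finset.sum_le_sum_of_subset Finset.subset_union_right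
  have hsum : ∑ p ∈ Z, (if a < p.re then
        (meromorphicOrderAt h p).untop₀ - (meromorphicOrderAt (symComb h a ε) p).untop₀
      else -((zeroMult (symComb h a ε) p / 2 : ℕ) : ℤ))
      = (∑ p ∈ Z, if p ∈ rightHalfPlane a then poleMult (symComb h a ε) p else 0 : ℕ)
        + (∑ p ∈ Z, if p ∈ rightHalfPlane a then zeroMult h p else 0 : ℕ)
        - (∑ p ∈ Z, if p ∈ rightHalfPlane a then poleMult h p else 0 : ℕ)
        - (∑ p ∈ Z, zeroWeight h a ε p : ℕ) := by
    push_cast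
    rw [← Finset.sum_add_distrib, ← Finset.sum_sub_distrib, ← Finset.sum_sub_distrib]
    refine Finset.sum_congr rfl fun p hp => ?_
    rw [untop₀_eq_zeroMult_sub_poleMult, untop₀_eq_zeroMult_sub_poleMult, zeroWeight]
    by_cases hre : a < p.re
    · have : p ∈ rightHalfPlane a := hre
      simp only [hre, this, if_true]
      ring
    · have h1 : p ∉ rightHalfPlane a := hre
      have h2 : p.re = a := le_antisymm (not_lt.1 hre) (hZ p hp)
      simp [h1, h2]
  rw [hsum] at key
  rw [e1, e2, e3]
  linarith [(Int.ofNat_le.2 hYZ)]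

/-- Each point of the support weighs at least 1, and the bound on the total does not depend on the
chosen finite set. -/
lemma finite_support_zeroWeight (H : ReflectionAdmissible h a) (ε : ℤˣ) :
    (Function.support (zeroWeight h a ε)).Finite := by
  by_contra hinf
  set K : ℤ := poleCount (symComb h a ε) (rightHalfPlane a)
      + zeroCount h (rightHalfPlane a) - poleCount h (rightHalfPlane a)
  obtain ⟨Y, hY, hcard⟩ := Set.Infinite.exists_subset_card_eq hinf (K.toNat + 1)
  have h1 := H.sum_zeroWeight_le ε Y fun p hp => by
    have := hY hp
    rw [Function.mem_support, zeroWeight] at this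
    by_contra hlt
    rw [if_neg (by linarith), if_neg (by linarith)] at this
    exact this rfl
  have h2 : Y.card ≤ ∑ p ∈ Y, zeroWeight h a ε p := by
    rw [Finset.card_eq_sum_ones]
    exact Finset.sum_le_sum fun p hp => Nat.one_le_iff_ne_zero.2 (hY hp)
  omega

end ReflectionAdmissible

/-! ### Symmetries of the zeros, finiteness and parity. -/

lemma finite_zeros_of_isCompact {m : ℂ → ℂ} (hm : Meromorphic m)
    (htop : ∀ s, meromorphicOrderAt m s ≠ ⊤) {K : Set ℂ} (hK : IsCompact K) :
    {s | s ∈ K ∧ IsZeroAt m s}.Finite := by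
  refine ((MeromorphicOn.divisor m K).finiteSupport hK).subset ?_
  rintro s ⟨hs, hz⟩
  rw [Function.mem_support, MeromorphicOn.divisor_apply hm.meromorphicOn hs]
  rw [IsZeroAt] at hz
  have := htop s
  lift meromorphicOrderAt m s to ℤ using this with n
  norm_cast at hz
  simpa using hz.ne'

lemma symComb_two_mul_sub (h : ℂ → ℂ) (a : ℝ) (ε : ℤˣ) (s : ℂ) :
    symComb h a ε (2 * (a : ℂ) - s) = ((ε : ℤ) : ℂ) * symComb h a ε s := by
  rw [symComb, symComb, sub_sub_cancel, mul_add, ← mul_assoc, unit_intCast_mul_self, one_mul,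
    add_comm]

lemma meromorphicOrderAt_symComb_two_mul_sub (h : ℂ → ℂ) (a : ℝ) (ε : ℤˣ) (s : ℂ) :
    meromorphicOrderAt (symComb h a ε) (2 * (a : ℂ) - s)
      = meromorphicOrderAt (symComb h a ε) s := by
  rw [← meromorphicOrderAt_comp_const_sub]
  simp_rw [symComb_two_mul_sub]
  exact meromorphicOrderAt_mul_of_ne_zero (g := fun _ => ((ε : ℤ) : ℂ)) analyticAt_const
    (fun h0 => by simpa [h0] using norm_unit_intCast ε)

lemma meromorphicOrderAt_symComb_conj {h : ℂ → ℂ} (hh : Meromorphic h) (hreal : RealOnRealAxis h)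
    (a : ℝ) (ε : ℤˣ) (s : ℂ) :
    meromorphicOrderAt (symComb h a ε) (starRingEnd ℂ s)
      = meromorphicOrderAt (symComb h a ε) s := by
  rw [← meromorphicOrderAt_conj_conj (meromorphic_symComb hh a ε _)]
  refine meromorphicOrderAt_congr ?_
  filter_upwards [hreal.conj_conj_eventuallyEq hh s,
    (tendsto_const_sub_nhdsNE (2 * (a : ℂ)) s).eventually
      (hreal.conj_conj_eventuallyEq hh (2 * (a : ℂ) - s))] with z h1 h2
  rw [symComb, symComb, map_add, map_mul, h1, ← h2]
  simp [map_ofNat]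

/-- Reflection in the line `σ = a`. -/
noncomputable def lineReflection (a : ℝ) (s : ℂ) : ℂ := 2 * (a : ℂ) - starRingEnd ℂ s

lemma lineReflection_involutive (a : ℝ) : Function.Involutive (lineReflection a) := fun s => by
  simp [lineReflection, map_ofNat]

@[simp]
lemma lineReflection_re (a : ℝ) (s : ℂ) : (lineReflection a s).re = 2 * a - s.re := by
  simp [lineReflection]

@[simp]
lemma lineReflection_im (a : ℝ) (s : ℂ) : (lineReflection a s).im = s.im := by
  simp [lineReflection]

lemma meromorphicOrderAt_symComb_lineReflection {h : ℂ → ℂ} (hh : Meromorphic h)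
    (hreal : RealOnRealAxis h) (a : ℝ) (ε : ℤˣ) (s : ℂ) :
    meromorphicOrderAt (symComb h a ε) (lineReflection a s)
      = meromorphicOrderAt (symComb h a ε) s := by
  rw [lineReflection, meromorphicOrderAt_symComb_two_mul_sub,
    meromorphicOrderAt_symComb_conj hh hreal]

/-- The part of the strip `0 < τ < T` with `σ > a`. -/
def rightStrip (a T : ℝ) : Set ℂ := {s | a < s.re ∧ 0 < s.im ∧ s.im < T}

namespace ReflectionAdmissible

variable {h : ℂ → ℂ} {a : ℝ}

/-- On the line `⌊m/2⌋ = 0` leaves only simple zeros; zeros with `σ < a` are reflected to `σ > a`.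
-/
lemma finite_exceptional_zeros (H : ReflectionAdmissible h a) (ε : ℤˣ) :
    {s | IsZeroAt (symComb h a ε) s ∧
      ¬ (s.re = a ∧ meromorphicOrderAt (symComb h a ε) s = 1)}.Finite := by
  have hfin := H.finite_support_zeroWeight ε
  refine (hfin.union (hfin.image (lineReflection a))).subset ?_
  rintro s ⟨hz, hs⟩
  have hm : ∀ {z}, IsZeroAt (symComb h a ε) z → zeroMult (symComb h a ε) z ≠ 0 := fun {z} hz h0 =>
    (zeroMult_eq_zero_iff (H.order_symComb_ne_top ε z)).1 h0 hz
  rcases lt_trichotomy s.re a with hre | hre | hre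
  · refine Or.inr ⟨lineReflection a s, ?_, lineReflection_involutive a s⟩
    rw [Function.mem_support, zeroWeight, if_pos (by simp; linarith)]
    refine hm ?_
    rwa [IsZeroAt, meromorphicOrderAt_symComb_lineReflection H.mero H.real]
  · left
    rw [Function.mem_support, zeroWeight, if_neg (by linarith), if_pos hre]
    have h1 := hm hz
    have h2 : zeroMult (symComb h a ε) s ≠ 1 := fun h1 =>
      hs ⟨hre, by rw [H.order_symComb_eq_zeroMult ε hre, h1]; rfl⟩
    omega
  · left
    rw [Function.mem_support, zeroWeight, if_pos hre]
    exact hm hz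

lemma finite_zeros_strip (H : ReflectionAdmissible h a) (ε : ℤˣ) (T : ℝ) :
    {s | s ∈ strip T ∧ IsZeroAt (symComb h a ε) s}.Finite := by
  have hK : IsCompact (({a} : Set ℝ) ×ℂ Set.Icc 0 T) := isCompact_singleton.reProdIm isCompact_Icc
  refine ((H.finite_exceptional_zeros ε).union (finite_zeros_of_isCompact
    (meromorphic_symComb H.mero a ε) (H.order_symComb_ne_top ε) hK)).subset ?_
  rintro s ⟨⟨h1, h2⟩, hz⟩
  by_cases hre : s.re = a
  · exact Or.inr ⟨by rw [Complex.mem_reProdIm]; exact ⟨hre, h1.le, h2.le⟩, hz⟩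
  · exact Or.inl ⟨hz, fun h => hre h.1⟩

lemma zeroMult_symComb_one (H : ReflectionAdmissible h a) :
    zeroMult (symComb h a 1) (a : ℂ) = 0 := by
  obtain ⟨u, hu, hu0, hev⟩ := (meromorphicOrderAt_eq_int_iff (n := 0) (H.mero a)).1
    (H.line a (by simp))
  have haa : 2 * (a : ℂ) - a = a := by ring
  have hev2 := (tendsto_const_sub_nhdsNE (2 * (a : ℂ)) a).eventually (by rw [haa]; exact hev)
  have hcomp : AnalyticAt ℂ (fun z => u (2 * (a : ℂ) - z)) a :=
    AnalyticAt.fun_comp (g := u) (f := fun z => 2 * (a : ℂ) - z) (by rwa [haa]) (by fun_prop)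
  have hf : symComb h a 1 =ᶠ[𝓝[≠] (a : ℂ)] fun z => u z + u (2 * (a : ℂ) - z) := by
    filter_upwards [hev, hev2] with z h1 h2
    rw [symComb, h1, h2]
    simp
  have hne : u a + u (2 * (a : ℂ) - a) ≠ 0 := by
    rw [haa, ← two_mul]
    exact mul_ne_zero two_ne_zero hu0
  have hord : meromorphicOrderAt (symComb h a 1) a = 0 := by
    rw [meromorphicOrderAt_congr hf]
    exact (hu.add hcomp).meromorphicNFAt.meromorphicOrderAt_eq_zero_iff.2 hne
  simp [zeroMult, hord]

/-- Comparing leading coefficients in `f(2a - s) = -f(s)` at `a` gives `(-1)ⁿ u(a) = -u(a)` with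
`u(a) ≠ 0`. -/
lemma odd_zeroMult_symComb_neg_one (H : ReflectionAdmissible h a) :
    Odd (zeroMult (symComb h a (-1)) (a : ℂ)) := by
  set n := zeroMult (symComb h a (-1)) (a : ℂ) with hn
  have hord := H.order_symComb_eq_zeroMult (-1) (s := (a : ℂ)) (by simp)
  rw [← hn, meromorphicOrderAt_eq_int_iff (meromorphic_symComb H.mero a _ _)] at hord
  obtain ⟨u, hu, hu0, hev⟩ := hord
  have haa : 2 * (a : ℂ) - a = a := by ring
  have hev2 := (tendsto_const_sub_nhdsNE (2 * (a : ℂ)) a).eventually (by rw [haa]; exact hev)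
  have hrel : ∀ᶠ z in 𝓝[≠] (a : ℂ), (-1) ^ n * u (2 * (a : ℂ) - z) = -u z := by
    filter_upwards [hev, hev2, self_mem_nhdsWithin] with z h1 h2 h3
    have h4 := symComb_two_mul_sub h a (-1) z
    rw [h1, h2] at h4
    have h5 : 2 * (a : ℂ) - z - a = -1 * (z - a) := by ring
    have h6 : (z - a) ^ n ≠ 0 := pow_ne_zero _ (sub_ne_zero.2 h3)
    rw [h5] at h4
    simp only [smul_eq_mul, zpow_natCast, mul_pow] at h4
    apply mul_left_cancel₀ h6
    simp at h4
    linear_combination h4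
  have hcomp : AnalyticAt ℂ (fun z => u (2 * (a : ℂ) - z)) a :=
    AnalyticAt.fun_comp (g := u) (f := fun z => 2 * (a : ℂ) - z) (by rwa [haa]) (by fun_prop)
  have l1 : Tendsto (fun z => (-1) ^ n * u (2 * (a : ℂ) - z)) (𝓝[≠] (a : ℂ))
      (𝓝 ((-1) ^ n * u a)) := by
    have := (hcomp.continuousAt.const_mul ((-1 : ℂ) ^ n)).tendsto
    rw [haa] at this
    exact this.mono_left nhdsWithin_le_nhds
  have l2 : Tendsto (fun z => -u z) (𝓝[≠] (a : ℂ)) (𝓝 (-u a)) :=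
    hu.continuousAt.neg.tendsto.mono_left nhdsWithin_le_nhds
  have heq := tendsto_nhds_unique (l1.congr' hrel) l2
  by_contra hodd
  rw [Nat.not_odd_iff_even] at hodd
  rw [hodd.neg_one_pow, one_mul, eq_neg_iff_add_eq_zero, ← two_mul] at heq
  exact mul_ne_zero two_ne_zero hu0 heq

/-- Reflection in the line preserves `τ` and multiplicities, so the zeros off the line pair up. -/
lemma zerosN_eq (H : ReflectionAdmissible h a) (ε : ℤˣ) (T : ℝ) :
    zerosN (symComb h a ε) T
      = zerosN₀ (symComb h a ε) a T + 2 * zeroCount (symComb h a ε) (rightStrip a T) := by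
  classical
  set f := symComb h a ε with hf
  have hfin := H.finite_zeros_strip ε T
  rw [← hf] at hfin
  set Q := hfin.toFinset
  have hQ : ∀ s ∈ strip T, zeroMult f s ≠ 0 → s ∈ Q := fun s hs h0 =>
    hfin.mem_toFinset.2 ⟨hs, not_not.1 (mt (zeroMult_eq_zero_iff (H.order_symComb_ne_top ε s)).2 h0)⟩
  have hbij : zeroCount f (rightStrip a T) = zeroCount f {s | s.re < a ∧ 0 < s.im ∧ s.im < T} := by
    refine finsum_mem_eq_of_bijOn (lineReflection a)
      (Set.InvOn.bijOn (f' := lineReflection a) ⟨fun s _ => lineReflection_involutive a s,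
        fun s _ => lineReflection_involutive a s⟩ ?_ ?_) ?_
    · rintro s ⟨h1, h2, h3⟩
      exact ⟨by simp; linarith, by simpa, by simpa⟩
    · rintro s ⟨h1, h2, h3⟩
      exact ⟨by simp; linarith, by simpa, by simpa⟩
    · exact fun s _ => (zeroMult_congr
        (meromorphicOrderAt_symComb_lineReflection H.mero H.real a ε s)).symm
  rw [two_mul]
  nth_rw 2 [hbij]
  rw [zerosN, zerosN₀, zeroCount, zeroCount, zeroCount, zeroCount,
    finsum_mem_eq_sum_ite _ _ Q hQ, finsum_mem_eq_sum_ite _ _ Q fun s hs => hQ s hs.2,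
    finsum_mem_eq_sum_ite _ _ Q fun s hs => hQ s hs.2,
    finsum_mem_eq_sum_ite _ _ Q fun s hs => hQ s hs.2, ← Finset.sum_add_distrib,
    ← Finset.sum_add_distrib]
  refine Finset.sum_congr rfl fun s hs => ?_
  have hs' : 0 < s.im ∧ s.im < T := (hfin.mem_toFinset.1 hs).1
  simp only [strip, criticalSegment, rightStrip, Set.mem_ofPred_eq, hs'.1, hs'.2, and_true, and_self,
    if_true]
  rcases lt_trichotomy s.re a with hre | hre | hre
  · simp [hre, hre.ne, hre.not_gt]
  · simp [hre]
  · simp [hre, hre.ne', hre.not_gt]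

end ReflectionAdmissible

/-! ### From weights to the counting functions. -/

namespace ReflectionAdmissible

variable {h : ℂ → ℂ} {a : ℝ}

/-- The comparison is pointwise: on the line it is `m ≤ 1 + 2⌊m/2⌋`. -/
lemma zerosN₀'_le (H : ReflectionAdmissible h a) (ε : ℤˣ) (T : ℝ) :
    zerosN₀' (symComb h a ε) a T ≤ zerosN₀ (symComb h a ε) a T ∧
    zerosN (symComb h a ε) T ≤ zerosN₀' (symComb h a ε) a T
      + 2 * ∑ᶠ s ∈ {s : ℂ | a ≤ s.re ∧ 0 < s.im ∧ s.im < T}, zeroWeight h a ε s := by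
  classical
  rw [H.zerosN_eq ε T]
  set f := symComb h a ε with hf
  have hfin := H.finite_zeros_strip ε T
  rw [← hf] at hfin
  set Q := hfin.toFinset
  have hmz : ∀ s, zeroMult f s = 0 ↔ ¬ IsZeroAt f s := fun s =>
    zeroMult_eq_zero_iff (H.order_symComb_ne_top ε s)
  have hQ : ∀ s ∈ strip T, zeroMult f s ≠ 0 → s ∈ Q := fun s hs h0 =>
    hfin.mem_toFinset.2 ⟨hs, not_not.1 (mt (hmz s).2 h0)⟩
  have hw : ∀ s, zeroWeight h a ε s ≠ 0 → zeroMult f s ≠ 0 := fun s h1 h0 => h1 (by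
    simp [zeroWeight, ← hf, h0])
  have e0 : zerosN₀' f a T = ∑ s ∈ Q, if s ∈ criticalSegment a T then 1 else 0 := by
    rw [← Finset.sum_filter, ← Finset.card_eq_sum_ones, zerosN₀', ← Set.ncard_coe_finset]
    congr 1
    ext s
    simp only [Finset.coe_filter, Set.mem_ofPred_eq, Q, hfin.mem_toFinset]
    exact ⟨fun h => ⟨⟨h.1.2, h.2⟩, h.1⟩, fun h => ⟨h.2, h.1.2⟩⟩
  have e1 : zerosN₀ f a T = ∑ s ∈ Q, if s ∈ criticalSegment a T then zeroMult f s else 0 :=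
    finsum_mem_eq_sum_ite _ _ _ fun s hs => hQ s hs.2
  have e2 : zeroCount f (rightStrip a T) = ∑ s ∈ Q, if s ∈ rightStrip a T then zeroMult f s else 0 :=
    finsum_mem_eq_sum_ite _ _ _ fun s hs => hQ s hs.2
  have e3 : ∑ᶠ s ∈ {s : ℂ | a ≤ s.re ∧ 0 < s.im ∧ s.im < T}, zeroWeight h a ε s
      = ∑ s ∈ Q, if s ∈ {s : ℂ | a ≤ s.re ∧ 0 < s.im ∧ s.im < T} then zeroWeight h a ε s else 0 :=
    finsum_mem_eq_sum_ite _ _ _ fun s hs h0 => hQ s hs.2 (hw s h0)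
  have hpos : ∀ s ∈ Q, 1 ≤ zeroMult f s := fun s hs =>
    Nat.one_le_iff_ne_zero.2 fun h0 => (hmz s).1 h0 (hfin.mem_toFinset.1 hs).2
  refine ⟨?_, ?_⟩
  · rw [e0, e1]
    refine Finset.sum_le_sum fun s hs => ?_
    split_ifs
    · exact hpos s hs
    · exact le_rfl
  · rw [e0, e1, e2, e3, Finset.mul_sum, Finset.mul_sum, ← Finset.sum_add_distrib,
      ← Finset.sum_add_distrib]
    refine Finset.sum_le_sum fun s hs => ?_
    have hs' : 0 < s.im ∧ s.im < T := (hfin.mem_toFinset.1 hs).1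
    simp only [criticalSegment, rightStrip, Set.mem_ofPred_eq, hs'.1, hs'.2, and_true,
      zeroWeight, ← hf]
    rcases lt_trichotomy s.re a with hre | hre | hre
    · simp [hre.ne, hre.not_gt]
    · simp only [hre, lt_irrefl, le_refl, if_true, if_false]
      omega
    · simp [hre, hre.ne', hre.le]

/-- The factor 2 is the upper part together with its conjugate. These two, the half-line and `{a}`
are disjoint, so each weight is used at most once. -/
lemma two_mul_finsum_zeroWeight_le (H : ReflectionAdmissible h a) (ε : ℤˣ) (T : ℝ) :
    ((2 * ∑ᶠ s ∈ {s : ℂ | a ≤ s.re ∧ 0 < s.im ∧ s.im < T}, zeroWeight h a ε s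
      + zeroCount (symComb h a ε) (rightHalfLine a) + zeroMult (symComb h a ε) (a : ℂ) / 2 : ℕ) : ℤ)
      ≤ poleCount (symComb h a ε) (rightHalfPlane a)
      + zeroCount h (rightHalfPlane a) - poleCount h (rightHalfPlane a) := by
  classical
  have hfin := H.finite_support_zeroWeight ε
  have hle := H.sum_zeroWeight_le ε hfin.toFinset fun p hp => by
    have hp' := hfin.mem_toFinset.1 hp
    rw [Function.mem_support, zeroWeight] at hp'
    by_contra hlt
    rw [if_neg (by linarith), if_neg (by linarith)] at hp'
    exact hp' rfl
  refine le_trans (Int.ofNat_le.2 ?_) hle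
  set Q := hfin.toFinset
  have hQ : ∀ s, zeroWeight h a ε s ≠ 0 → s ∈ Q := fun s hs => hfin.mem_toFinset.2 hs
  have hbij : ∑ᶠ s ∈ {s : ℂ | a ≤ s.re ∧ 0 < s.im ∧ s.im < T}, zeroWeight h a ε s
      = ∑ᶠ s ∈ {s : ℂ | a ≤ s.re ∧ 0 < -s.im ∧ -s.im < T}, zeroWeight h a ε s := by
    refine finsum_mem_eq_of_bijOn (starRingEnd ℂ)
      (Set.InvOn.bijOn (f' := starRingEnd ℂ) ⟨fun s _ => Complex.conj_conj s,
        fun s _ => Complex.conj_conj s⟩ ?_ ?_) ?_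
    · rintro s ⟨h1, h2, h3⟩
      exact ⟨by simpa, by simpa, by simpa⟩
    · rintro s ⟨h1, h2, h3⟩
      exact ⟨by simpa, by simpa using h2, by simpa using h3⟩
    · intro s _
      rw [zeroWeight, zeroWeight, Complex.conj_re,
        zeroMult_congr (meromorphicOrderAt_symComb_conj H.mero H.real a ε s)]
  have hline : zeroCount (symComb h a ε) (rightHalfLine a)
      = ∑ᶠ s ∈ rightHalfLine a, zeroWeight h a ε s :=
    finsum_mem_congr rfl fun s hs => by rw [zeroWeight, if_pos hs.1]
  have hpt : zeroMult (symComb h a ε) (a : ℂ) / 2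
      = ∑ᶠ s ∈ ({(a : ℂ)} : Set ℂ), zeroWeight h a ε s := by
    rw [finsum_mem_singleton, zeroWeight]
    simp
  rw [two_mul, hline, hpt]
  nth_rw 2 [hbij]
  rw [finsum_mem_eq_sum_ite _ _ Q fun s _ => hQ s, finsum_mem_eq_sum_ite _ _ Q fun s _ => hQ s,
    finsum_mem_eq_sum_ite _ _ Q fun s _ => hQ s, finsum_mem_eq_sum_ite _ _ Q fun s _ => hQ s,
    ← Finset.sum_add_distrib, ← Finset.sum_add_distrib, ← Finset.sum_add_distrib]
  refine Finset.sum_le_sum fun s _ => ?_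
  simp only [rightHalfLine, Set.mem_ofPred_eq, Set.mem_singleton_iff]
  rcases lt_trichotomy s.im 0 with him | him | him
  · have h1 : ¬ s = a := fun h => him.ne (by simp [h])
    simp only [him.not_gt, him.ne, h1, and_false, false_and, if_false, zero_add, add_zero]
    split_ifs <;> simp
  · by_cases h1 : s = a
    · simp [h1]
    · simp only [him, h1, lt_irrefl, neg_zero, and_true, and_false, false_and, if_false, zero_add,
        add_zero]
      split_ifs <;> simp
  · have h1 : ¬ s = a := fun h => him.ne' (by simp [h])
    have h2 : ¬ 0 < -s.im := by linarith
    simp only [h2, him.ne', h1, and_false, false_and, if_false, add_zero]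
    split_ifs <;> simp

lemma finite_zeros_rightHalfLine (H : ReflectionAdmissible h a) (ε : ℤˣ) :
    {s | s ∈ rightHalfLine a ∧ IsZeroAt (symComb h a ε) s}.Finite :=
  (H.finite_exceptional_zeros ε).subset fun _ hs => ⟨hs.2, fun h => hs.1.1.ne' h.1⟩

end ReflectionAdmissible

theorem mainTheorem1 (a : ℝ) (h : ℂ → ℂ) (hmero : Meromorphic h)
    (hreal : RealOnRealAxis h)
    (hpoles : {s | IsPoleAt h s}.Finite)
    (hzeros : {s | s ∈ rightHalfPlane a ∧ IsZeroAt h s}.Finite)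
    (hline : ∀ s : ℂ, s.re = a → meromorphicOrderAt h s = 0)
    (hF_right : ∀ η > 0, ∃ σ₀ > a, ∀ s : ℂ, σ₀ ≤ s.re → NormLtAt (reflQuot h a) s η)
    (hF_horiz : ∀ δ > 0, ∀ σ₀ > a, ∃ t : ℕ → ℝ, Tendsto t atTop atTop ∧
      ∀ (n : ℕ) (s : ℂ), a ≤ s.re → s.re ≤ σ₀ → |s.im| = t n →
        NormLtAt (reflQuot h a) s (Real.exp (δ * ‖s‖)))
    (ε : ℤˣ) (f : ℂ → ℂ) (hf : f = symComb h a ε) :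
    -- functional equation
    (∀ s : ℂ, f (2 * (a : ℂ) - s) = ((ε : ℤ) : ℂ) * f s) ∧
    -- the quantities counted below are finite
    (∀ T > 0, {s | s ∈ strip T ∧ IsZeroAt f s}.Finite) ∧
    {s | s ∈ rightHalfLine a ∧ IsZeroAt f s}.Finite ∧
    {s | s ∈ rightHalfPlane a ∧ IsPoleAt f s}.Finite ∧
    meromorphicOrderAt f (a : ℂ) ≠ ⊤ ∧
    -- the main estimate
    (∀ T > 0,
      (zerosN f T : ℝ) - zerosN₀ f a T ≤ (zerosN f T : ℝ) - zerosN₀' f a T ∧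
      (zerosN f T : ℝ) - zerosN₀' f a T ≤
        uConst ε - zeroCount f (rightHalfLine a) - (zeroMult f (a : ℂ) : ℝ) / 2
          + poleCount f (rightHalfPlane a) + zeroCount h (rightHalfPlane a)
          - poleCount h (rightHalfPlane a)) ∧
    -- the multiplicity of `a` as a zero of `f`
    (ε = 1 → zeroMult f (a : ℂ) = 0) ∧
    (ε = -1 → 1 ≤ zeroMult f (a : ℂ) ∧ Odd (zeroMult f (a : ℂ))) ∧
    -- all but finitely many zeros of `f` lie on `σ = a` and are simple
    {s | IsZeroAt f s ∧ ¬ (s.re = a ∧ meromorphicOrderAt f s = 1)}.Finite ∧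
    -- `N(T) - N₀(T)` is a nonnegative even integer
    (∀ T > 0, 0 ≤ (zerosN f T : ℤ) - zerosN₀ f a T ∧
      Even ((zerosN f T : ℤ) - zerosN₀ f a T)) := by
  subst hf
  have H : ReflectionAdmissible h a :=
    ⟨hmero, hreal, hpoles, hzeros, hline, hF_right, hF_horiz⟩
  refine ⟨symComb_two_mul_sub h a ε, fun T _ => H.finite_zeros_strip ε T,
    H.finite_zeros_rightHalfLine ε, H.finite_poles_symComb ε, H.order_symComb_ne_top ε a,
    fun T _ => ?_, ?_, ?_, H.finite_exceptional_zeros ε, fun T _ => ?_⟩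
  · obtain ⟨h1, h2⟩ := H.zerosN₀'_le ε T
    have h3 := H.two_mul_finsum_zeroWeight_le ε T
    -- Rounding down loses at most `1/2`, which suffices for either sign since `1/2 ≤ u`.
    have hhalf : (zeroMult (symComb h a ε) (a : ℂ) : ℝ) / 2
        ≤ ((zeroMult (symComb h a ε) (a : ℂ) / 2 : ℕ) : ℝ) + uConst ε := by
      have h4 : zeroMult (symComb h a ε) (a : ℂ)
          ≤ 2 * (zeroMult (symComb h a ε) (a : ℂ) / 2) + 1 := by omega
      have h5 : (zeroMult (symComb h a ε) (a : ℂ) : ℝ)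
          ≤ 2 * ((zeroMult (symComb h a ε) (a : ℂ) / 2 : ℕ) : ℝ) + 1 := by exact_mod_cast h4
      have h6 : 1 / 2 ≤ uConst ε := by
        rw [uConst]
        split_ifs <;> norm_num
      linarith
    -- The rounded half stays an opaque natural number, so that the casts do not disturb the integer
    -- division.
    generalize zeroMult (symComb h a ε) (a : ℂ) / 2 = k at h3 hhalf
    have h1' : (zerosN₀' (symComb h a ε) a T : ℝ) ≤ zerosN₀ (symComb h a ε) a T := by
      exact_mod_cast h1
    have h2' : (zerosN (symComb h a ε) T : ℝ) ≤ zerosN₀' (symComb h a ε) a T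
      + 2 * (∑ᶠ s ∈ {s : ℂ | a ≤ s.re ∧ 0 < s.im ∧ s.im < T},
          ReflectionAdmissible.zeroWeight h a ε s : ℕ) := by
      exact_mod_cast h2
    have h3' := (Int.cast_le (R := ℝ)).2 h3
    push_cast at h3'
    constructor <;> linarith
  · rintro rfl
    exact H.zeroMult_symComb_one
  · rintro rfl
    exact ⟨H.odd_zeroMult_symComb_neg_one.pos, H.odd_zeroMult_symComb_neg_one⟩
  · rw [H.zerosN_eq ε T]
    push_cast
    rw [add_sub_cancel_left]
    exact ⟨by positivity, even_two_mul _⟩
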